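/- Let $a,b,c,\nu\in\mathbb C$, where $\nu$ is not a negative integer and $a\nu^2+c+(b-a)\nu\neq 0$. Let $J_\nu$ be the Bessel function of the first kind, put $$N_\nu(z)=az^2J_\nu''(z)+bzJ_\nu'(z)+cJ_\nu(z),$$ $$p=2a(a\nu^2+c)+(a^2-b^2),\quad q=(a\nu^2+c)^2-\nu^2(a-b)^2,\quad r=a\nu^2(3a-b)+c(a+b).$$ Then $z^{-\nu}N_\nu(z)$ (principal branches, $z\in\mathbb C\setminus(-\infty,0]$) extends to an even entire function. It has infinitely many zeros, which can be listed with multiplicity as $\pm t_1,\pm t_2,\dots$, and none of them is $0$. For every such listing put $\zeta_k=t_k^2$ and $\tau_n=\sum_{k=1}^\infty\zeta_k^{-n}$ for $n\ge1$. These series converge absolutely, and $$\tau_1=\frac{2\nu p+q+2r}{4q(\nu+1)}\qquad\text{if } q\neq0,$$ $$4q(\nu+2)\tau_2=4q\tau_1^2+4\nu p\,\tau_1-p-4a^2\nu+2a(a+b),$$ $$4q(\nu+3)\tau_3=4p(\nu+1)\tau_2-4a^2(\nu-1)\tau_1+a^2+8q\tau_1\tau_2-4p\tau_1^2,$$ and,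 for every $k\ge3$, $$q(k+\nu+1)\tau_{k+1}=p(k+\nu-1)\tau_k-a^2(k+\nu-3)\tau_{k-1}+q\sum_{m=1}^{k}\tau_m\tau_{k-m+1}-p\sum_{m=1}^{k-1}\tau_m\tau_{k-m}+a^2\sum_{m=1}^{k-2}\tau_m\tau_{k-m-1}.$$ In the special case $a=b=0$, $c=1$ one has $p=0$, $q=1$, $r=0$ and $N_\nu=J_\nu$, and the sums, then denoted $\sigma_n$, satisfy $$\sigma_1=\frac1{4(\nu+1)},\qquad \sigma_n=\frac1{\nu+n}\sum_{k=1}^{n-1}\sigma_k\sigma_{n-k}\quad(n\ge2).$$ -/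

import Mathlib

noncomputable section

/-- The Bessel function of the first kind
`J_ν(z) = ∑ (-1)^n (z/2)^(2n+ν) / (n! Γ(ν+n+1))`, with the principal branch of the power
(it is used on the slit plane only). -/
def besselJ (ν z : ℂ) : ℂ :=
  ∑' n : ℕ, (-1 : ℂ) ^ n * (z / 2) ^ (2 * (n : ℂ) + ν) /
    ((n.factorial : ℂ) * Complex.Gamma (ν + n + 1))

/-- `N_ν(z) = a z² J_ν''(z) + b z J_ν'(z) + c J_ν(z)`. -/
def besselN (a b c ν z : ℂ) : ℂ :=
  a * z ^ 2 * iteratedDeriv 2 (besselJ ν) z + b * z * deriv (besselJ ν) z + c * besselJ ν z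

/-- `F` is the entire function `z^(-ν) f(z)`: it is entire, and it is given by that expression on
the plane cut along the negative real axis, where the principal branches are analytic. By the
identity theorem there is at most one such `F`. -/
def IsEntireQuotient (ν : ℂ) (f F : ℂ → ℂ) : Prop :=
  Differentiable ℂ F ∧ ∀ z ∈ Complex.slitPlane, F z = z ^ (-ν) * f z

/-- The list `t 0, -t 0, t 1, -t 1, …` consists of all the zeros of `F`, each occurring as
many times as its multiplicity. -/
def IsZeroPairSequence (F : ℂ → ℂ) (t : ℕ → ℂ) : Prop :=
  ∀ w : ℂ, {k : ℕ | t k = w}.encard + {k : ℕ | -t k = w}.encard = analyticOrderAt F w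

/-- The Rayleigh sum `τ_n = ∑ ζ_k^(-n)` with `ζ_k = t_k²`. -/
def rayleighSum (t : ℕ → ℂ) (n : ℕ) : ℂ := ∑' k : ℕ, ((t k ^ 2) ^ n)⁻¹

/-- `p = 2a(aν² + c) + (a² - b²)`. -/
def coeffP (a b c ν : ℂ) : ℂ := 2 * a * (a * ν ^ 2 + c) + (a ^ 2 - b ^ 2)

/-- `q = (aν² + c)² - ν²(a - b)²`. -/
def coeffQ (a b c ν : ℂ) : ℂ := (a * ν ^ 2 + c) ^ 2 - ν ^ 2 * (a - b) ^ 2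

/-- `r = aν²(3a - b) + c(a + b)`. -/
def coeffR (a b c ν : ℂ) : ℂ := a * ν ^ 2 * (3 * a - b) + c * (a + b)

end

/-! Write `z^(-ν) J_ν(z) = H(z²)` and `z^(-ν) N_ν(z) = G(z²)`, and let `θ = x d/dx`. The `ζ_k` are
exactly the zeros of the entire function `G`, and the recurrences are the coefficients of a Riccati
equation for `S = ∑ τ_n x^n`. This requires two things.

Analysis: `S = -θG/G`. The coefficients of `G` are `O(K^n/(2n)!)`, so `|G(w)| ≤ C exp(K√|w|)`.
Growth of order 1/2 makes `∑ 1/|ζ_k|` converge and leaves no exponential factor in the factorization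
of `G`. The infinite product is avoided: the zeros with `|ζ_k| ≤ R` are divided out, and the maximum
principle and Borel–Carathéodory show that the nonconstant Taylor coefficients of the cofactor tend
to 0 as `R → ∞`. The logarithmic derivative identity of the finite products then passes to the limit
coefficientwise (`ListsZeros.X_mul_derivative`). If there were only finitely many zeros, the same
estimate would make `G` a polynomial, which its explicit coefficients exclude.

Algebra: Bessel's equation reads `4θ²H + 4νθH = -xH`. With it `G` and `θG` become combinations of
`H` and `θH` whose determinant is `q - px + a²x²`. Eliminating `H` gives a second order equation for
`G`, and substituting `θG = -SG`, `θ²G = (S² - θS)G` gives the Riccati equation (`riccati_algebra`,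
`riccati_series`). Its inhomogeneous part has degree at most 3 in `x`, hence three special relations
and then a uniform recurrence. -/

open Filter Topology

/-! ### Taylor series and entire power series -/

/-- The Taylor series at `0` of a function of a complex variable. -/
noncomputable def taylorAtZero (f : ℂ → ℂ) : PowerSeries ℂ :=
  PowerSeries.mk fun n => iteratedDeriv n f 0 / (n.factorial : ℂ)

theorem coeff_taylorAtZero (f : ℂ → ℂ) (n : ℕ) :
    PowerSeries.coeff n (taylorAtZero f) = iteratedDeriv n f 0 / (n.factorial : ℂ) := by
  simp [taylorAtZero]

theorem taylorAtZero_mul {f g : ℂ → ℂ} (hf : Differentiable ℂ f) (hg : Differentiable ℂ g) :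
    taylorAtZero (fun w => f w * g w) = taylorAtZero f * taylorAtZero g := by
  ext n
  rw [PowerSeries.coeff_mul, coeff_taylorAtZero,
    Finset.Nat.sum_antidiagonal_eq_sum_range_succ_mk]
  have := iteratedDeriv_mul (n := n) (x := 0) (hf.contDiff.contDiffAt) (hg.contDiff.contDiffAt)
  change iteratedDeriv n (f * g) 0 / _ = _
  rw [this, Finset.sum_div]
  refine Finset.sum_congr rfl fun i hi => ?_
  have hin : i ≤ n := by simpa [Nat.lt_succ_iff] using hi
  rw [coeff_taylorAtZero, coeff_taylorAtZero, Nat.cast_choose ℂ hin]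
  have h1 := Nat.factorial_ne_zero n
  have h2 := Nat.factorial_ne_zero i
  have h3 := Nat.factorial_ne_zero (n - i)
  field_simp

/-- Coefficient sequences of entire functions. -/
def IsEntireCoeff (u : ℕ → ℂ) : Prop := ∀ R : ℝ, 0 ≤ R → Summable fun n => ‖u n‖ * R ^ n

/-- The sum of a power series in one complex variable. -/
noncomputable def powSum (u : ℕ → ℂ) (w : ℂ) : ℂ := ∑' n, u n * w ^ n

theorem IsEntireCoeff.summable {u : ℕ → ℂ} (hu : IsEntireCoeff u) (w : ℂ) :
    Summable fun n => u n * w ^ n := by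
  refine Summable.of_norm ?_
  simpa using hu ‖w‖ (norm_nonneg _)

/-- The linear factor is at most a constant times `2 ^ n`, so it is absorbed by doubling the radius.
-/
theorem IsEntireCoeff.linear_mul {u : ℕ → ℂ} (hu : IsEntireCoeff u) (μ : ℂ) :
    IsEntireCoeff fun n => (μ + 2 * n) * u n := fun R hR => by
  refine Summable.of_nonneg_of_le (fun n => by positivity) (fun n => ?_)
    ((hu (2 * R) (by positivity)).mul_left (‖μ‖ + 2))
  have h1 : (n : ℝ) ≤ 2 ^ n := by exact_mod_cast n.lt_two_pow_self.le
  have h2 : (1 : ℝ) ≤ 2 ^ n := one_le_pow₀ (by norm_num)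
  have : ‖μ + 2 * (n : ℂ)‖ ≤ (‖μ‖ + 2) * 2 ^ n := by
    refine (norm_add_le _ _).trans ?_
    simp only [norm_mul, Complex.norm_ofNat, Complex.norm_natCast]
    nlinarith [norm_nonneg μ]
  calc _ = ‖μ + 2 * (n : ℂ)‖ * (‖u n‖ * R ^ n) := by rw [norm_mul]; ring
    _ ≤ (‖μ‖ + 2) * 2 ^ n * (‖u n‖ * R ^ n) := by gcongr
    _ = _ := by rw [mul_pow]; ring

theorem IsEntireCoeff.hasSum_deriv {u : ℕ → ℂ} (hu : IsEntireCoeff u) (w : ℂ) :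
    HasSum (fun n => u n * (n * w ^ (n - 1))) (deriv (powSum u) w) ∧
      DifferentiableAt ℂ (powSum u) w := by
  have hb := hu (‖w‖ + 1) (by positivity)
  have hd : ∀ n : ℕ, DifferentiableOn ℂ (fun w => u n * w ^ n) (Metric.ball 0 (‖w‖ + 1)) :=
    fun n => by fun_prop
  have hle : ∀ (n : ℕ) (x : ℂ), x ∈ Metric.ball (0 : ℂ) (‖w‖ + 1) →
      ‖u n * x ^ n‖ ≤ ‖u n‖ * (‖w‖ + 1) ^ n := fun n x hx => by
    rw [norm_mul, norm_pow]
    gcongr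
    simpa using (Metric.mem_ball.1 hx).le
  have hw : w ∈ Metric.ball (0 : ℂ) (‖w‖ + 1) := by simp
  constructor
  · have := Complex.hasSum_deriv_of_summable_norm hb hd Metric.isOpen_ball hle hw
    simp only [deriv_const_mul_field, deriv_pow_field] at this
    exact this
  · exact (Complex.differentiableOn_tsum_of_summable_norm hb hd Metric.isOpen_ball
      hle).differentiableAt (Metric.isOpen_ball.mem_nhds hw)

theorem IsEntireCoeff.differentiable {u : ℕ → ℂ} (hu : IsEntireCoeff u) :
    Differentiable ℂ (powSum u) := fun w => (hu.hasSum_deriv w).2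

theorem IsEntireCoeff.deriv_eq {u : ℕ → ℂ} (hu : IsEntireCoeff u) :
    deriv (powSum u) = powSum fun n => (n + 1) * u (n + 1) := by
  ext w
  have h := (hu.hasSum_deriv w).1
  rw [← hasSum_nat_add_iff' 1] at h
  simp only [Finset.range_one, Finset.sum_singleton, Nat.cast_zero, zero_mul, mul_zero,
    sub_zero] at h
  rw [← h.tsum_eq]
  refine tsum_congr fun n => ?_
  rw [Nat.add_sub_cancel]
  push_cast
  ring

theorem IsEntireCoeff.shift {u : ℕ → ℂ} (hu : IsEntireCoeff u) :
    IsEntireCoeff fun n => (n + 1) * u (n + 1) := fun R hR => by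
  -- `μ = 0` supplies the factor `2(n+1)`. The radius `R + 1 ≥ 1` compensates for the exponent `n +
  -- 1` in place of `n`.
  have h := (summable_nat_add_iff 1).2 (hu.linear_mul 0 (R + 1) (by positivity))
  refine Summable.of_nonneg_of_le (fun n => by positivity) (fun n => ?_) h
  simp only [zero_add, norm_mul, Complex.norm_ofNat]
  have h1 : ‖((n + 1 : ℕ) : ℂ)‖ = ‖(n : ℂ) + 1‖ := by push_cast; rfl
  rw [h1]
  have h2 : R ^ n ≤ (R + 1) ^ (n + 1) := by
    calc R ^ n ≤ (R + 1) ^ n := by gcongr; linarith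
      _ ≤ (R + 1) ^ (n + 1) := by gcongr <;> linarith
  have : ‖(n : ℂ) + 1‖ * ‖u (n + 1)‖ * R ^ n ≤ ‖(n : ℂ) + 1‖ * ‖u (n + 1)‖ * (R + 1) ^ (n + 1) := by
    gcongr
  have h3 : 0 ≤ ‖(n : ℂ) + 1‖ * ‖u (n + 1)‖ * (R + 1) ^ (n + 1) := by positivity
  linarith

theorem powSum_zero (u : ℕ → ℂ) : powSum u 0 = u 0 := by
  rw [powSum, tsum_eq_single 0 (fun n hn => by simp [hn])]
  simp

theorem IsEntireCoeff.taylorAtZero_powSum {u : ℕ → ℂ} (hu : IsEntireCoeff u) :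
    taylorAtZero (powSum u) = PowerSeries.mk u := by
  ext n
  rw [coeff_taylorAtZero, PowerSeries.coeff_mk]
  induction n generalizing u with
  | zero => simp [powSum_zero]
  | succ n ih =>
    have := ih hu.shift
    rw [iteratedDeriv_succ', hu.deriv_eq]
    rw [div_eq_iff (by exact_mod_cast n.factorial_ne_zero)] at this
    rw [this, div_eq_iff (by exact_mod_cast (n + 1).factorial_ne_zero), Nat.factorial_succ]
    push_cast
    ring

/-- Termwise this is the derivative of `u n * z ^ (μ + 2n)`; the result has the same shape with `μ -
1`, so it can be iterated. -/
theorem IsEntireCoeff.hasDerivAt_cpow_mul {u : ℕ → ℂ} (hu : IsEntireCoeff u) (μ : ℂ) {z : ℂ}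
    (hz : z ∈ Complex.slitPlane) :
    HasDerivAt (fun z => z ^ μ * powSum u (z ^ 2))
      (z ^ (μ - 1) * powSum (fun n => (μ + 2 * n) * u n) (z ^ 2)) z := by
  have hz0 : z ≠ 0 := Complex.slitPlane_ne_zero hz
  have h1 : HasDerivAt (fun z : ℂ => z ^ μ) (μ * z ^ (μ - 1)) z := by
    simpa using (hasDerivAt_id z).cpow_const hz
  have h2 : HasDerivAt (fun z : ℂ => powSum u (z ^ 2)) (deriv (powSum u) (z ^ 2) * (2 * z)) z := by
    refine ((hu.differentiable (z ^ 2)).hasDerivAt.comp z (hasDerivAt_pow 2 z)).congr_deriv ?_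
    simp
  refine (h1.mul h2).congr_deriv ?_
  have hs : powSum (fun n => (μ + 2 * n) * u n) (z ^ 2) =
      μ * powSum u (z ^ 2) + 2 * z ^ 2 * deriv (powSum u) (z ^ 2) := by
    have ha := (hu.summable (z ^ 2)).hasSum.mul_left μ
    have hb := ((hu.hasSum_deriv (z ^ 2)).1).mul_left (2 * z ^ 2)
    refine Eq.trans ?_ (ha.add hb).tsum_eq
    refine tsum_congr fun n => ?_
    rcases n with _ | n
    · simp
    · rw [Nat.add_sub_cancel]
      push_cast
      ring
  have hc : z ^ μ = z ^ (μ - 1) * z := by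
    rw [Complex.cpow_sub _ _ hz0, Complex.cpow_one]
    field_simp
  rw [hs, hc]
  ring

/-! ### Dividing out zeros, and counting them -/

/-- The family `ζ` lists all the zeros of `G`, each as often as its multiplicity. -/
def ListsZeros {ι : Type*} (G : ℂ → ℂ) (ζ : ι → ℂ) : Prop :=
  ∀ w : ℂ, {i | ζ i = w}.encard = analyticOrderAt G w

/-- `g` is what remains of the entire function `G` after division by the factors `1 - w / ζ i`
with `i ∈ s`. -/
structure IsCofactor {ι : Type*} (G : ℂ → ℂ) (ζ : ι → ℂ) (s : Finset ι) (g : ℂ → ℂ) : Prop where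
  differentiable : Differentiable ℂ g
  eq_prod_mul : ∀ w, G w = (∏ i ∈ s, (1 - (ζ i)⁻¹ * w)) * g w
  encard_eq : ∀ w, {i | i ∉ s ∧ ζ i = w}.encard = analyticOrderAt g w

section Cofactor

variable {ι : Type*} {G : ℂ → ℂ} {ζ : ι → ℂ} {s : Finset ι} {g : ℂ → ℂ}

theorem ListsZeros.apply_ne_zero (hG : ListsZeros G ζ) (h0 : G 0 ≠ 0) (i : ι) : ζ i ≠ 0 := by
  intro hi
  have h : analyticOrderAt G 0 = 0 := analyticOrderAt_eq_zero.2 (Or.inr h0)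
  rw [← hG 0, Set.encard_eq_zero] at h
  exact (Set.ext_iff.1 h i).1 hi

theorem analyticOrderAt_one_sub_inv_mul {x : ℂ} (hx : x ≠ 0) (w : ℂ) [Decidable (x = w)] :
    analyticOrderAt (fun w => 1 - x⁻¹ * w) w = if x = w then 1 else 0 := by
  split_ifs with h
  · subst h
    have ha : AnalyticAt ℂ (fun w => 1 - x⁻¹ * w) x := by fun_prop
    have hd : deriv (fun w => 1 - x⁻¹ * w) x ≠ 0 := by
      have : HasDerivAt (fun w => 1 - x⁻¹ * w) (-x⁻¹) x := by
        simpa using ((hasDerivAt_id x).const_mul x⁻¹).const_sub 1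
      rw [this.deriv]
      simpa using hx
    have := ha.analyticOrderAt_sub_eq_one_of_deriv_ne_zero hd
    simpa [hx] using this
  · refine analyticOrderAt_eq_zero.2 (Or.inr fun h' => h ?_)
    field_simp at h'
    rw [mul_zero] at h'
    exact sub_eq_zero.1 h'

/-- Since `g` vanishes at `ζ j`, it equals `(w - ζ j) * dslope g (ζ j) w`, which is `1 - w / ζ j`
times `-ζ j * dslope g (ζ j) w`. Orders add, and the linear factor has order 1 at `ζ j` and 0
elsewhere. -/
theorem IsCofactor.exists_insert [DecidableEq ι] (hg : IsCofactor G ζ s g) {j : ι} (hj : j ∉ s)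
    (hζ : ζ j ≠ 0) : ∃ g', IsCofactor G ζ (insert j s) g' := by
  classical
  have hz : g (ζ j) = 0 := by
    by_contra h
    have h1 : analyticOrderAt g (ζ j) = 0 := analyticOrderAt_eq_zero.2 (Or.inr h)
    rw [← hg.encard_eq, Set.encard_eq_zero] at h1
    exact (Set.ext_iff.1 h1 j).1 ⟨hj, rfl⟩
  have hd : Differentiable ℂ (fun w => -ζ j * dslope g (ζ j) w) := by
    refine Differentiable.const_mul ?_ _
    rw [← differentiableOn_univ, Complex.differentiableOn_dslope univ_mem]
    exact hg.differentiable.differentiableOn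
  have hmul : g = (fun w => 1 - (ζ j)⁻¹ * w) * fun w => -ζ j * dslope g (ζ j) w := by
    ext w
    have := sub_smul_dslope_of_zero hz w
    rw [smul_eq_mul] at this
    simp only [Pi.mul_apply]
    nth_rw 1 [← this]
    field_simp
    ring
  refine ⟨fun w => -ζ j * dslope g (ζ j) w, hd, fun w => ?_, fun w => ?_⟩
  · rw [Finset.prod_insert hj, hg.eq_prod_mul w]
    nth_rw 1 [hmul]
    simp only [Pi.mul_apply]
    ring
  · have h := hg.encard_eq w
    rw [hmul, analyticOrderAt_mul (by fun_prop) (hd.analyticAt w),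
      analyticOrderAt_one_sub_inv_mul hζ w] at h
    split_ifs at h with hw
    · have hset : {i | i ∉ s ∧ ζ i = w} = insert j {i | i ∉ insert j s ∧ ζ i = w} := by
        ext i
        by_cases hij : i = j
        · subst hij; simp [hj, hw]
        · simp [hij]
      rw [hset, Set.encard_insert_of_notMem (by simp), add_comm] at h
      exact ENat.add_left_injective_of_ne_top ENat.one_ne_top (by simpa [add_comm] using h)
    · rw [zero_add] at h
      rw [← h]
      congr 1
      ext i
      by_cases hij : i = j
      · subst hij; simp [hw]
      · simp [hij]

theorem ListsZeros.exists_isCofactor (hG : ListsZeros G ζ) (hd : Differentiable ℂ G)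
    (h0 : G 0 ≠ 0) (s : Finset ι) : ∃ g, IsCofactor G ζ s g := by
  classical
  induction s using Finset.induction_on with
  | empty => exact ⟨G, hd, by simp, by simpa [ListsZeros] using hG⟩
  | insert j s hj ih =>
    obtain ⟨g, hg⟩ := ih
    exact hg.exists_insert hj (hG.apply_ne_zero h0 j)

theorem IsCofactor.apply_zero (hg : IsCofactor G ζ s g) : g 0 = G 0 := by
  simp [hg.eq_prod_mul 0]

/-- On the circle of radius `(c + 1) R` each divided factor has modulus at least `|z / ζ i| - 1 ≥
c`, so the growth bound for `G` transfers to `g` there, and by the maximum principle to the whole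
disc. -/
theorem IsCofactor.norm_mul_pow_le (hg : IsCofactor G ζ s g) {C K R c : ℝ}
    (hgrowth : ∀ w, ‖G w‖ ≤ C * Real.exp (K * √‖w‖)) (hR : 0 < R) (hc : 0 ≤ c)
    (hs : ∀ i ∈ s, ζ i ≠ 0 ∧ ‖ζ i‖ ≤ R) {w : ℂ} (hw : ‖w‖ ≤ (c + 1) * R) :
    ‖g w * (c : ℂ) ^ s.card‖ ≤ C * Real.exp (K * √((c + 1) * R)) := by
  have hpos : 0 < (c + 1) * R := by positivity
  refine Complex.norm_le_of_forall_mem_frontier_norm_le (U := Metric.ball 0 ((c + 1) * R))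
    (f := fun w => g w * (c : ℂ) ^ s.card)
    Metric.isBounded_ball (hg.differentiable.mul_const _).diffContOnCl (fun z hz => ?_) ?_
  · rw [frontier_ball _ hpos.ne', mem_sphere_zero_iff_norm] at hz
    have h1 : c ^ s.card ≤ ‖∏ i ∈ s, (1 - (ζ i)⁻¹ * z)‖ := by
      rw [norm_prod, ← Finset.prod_const]
      refine Finset.prod_le_prod (fun _ _ => hc) fun i hi => ?_
      obtain ⟨hi0, hiR⟩ := hs i hi
      have hi1 : 0 < ‖ζ i‖ := norm_pos_iff.2 hi0
      have h2 : c + 1 ≤ ‖(ζ i)⁻¹ * z‖ := by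
        rw [norm_mul, norm_inv, hz, inv_mul_eq_div, le_div_iff₀ hi1]
        gcongr
      have h3 := norm_sub_norm_le ((ζ i)⁻¹ * z) 1
      rw [norm_sub_rev, norm_one] at h3
      linarith
    have h4 := hgrowth z
    rw [hg.eq_prod_mul z, norm_mul, hz] at h4
    refine le_trans ?_ h4
    rw [norm_mul, norm_pow, Complex.norm_real, Real.norm_of_nonneg hc, mul_comm]
    gcongr
  · rw [closure_ball _ hpos.ne']
    simpa using hw

/-- The counting function of the zeros of an entire function of order `1/2` is `O(√R)`. -/
theorem ListsZeros.exists_card_le (hG : ListsZeros G ζ) (hd : Differentiable ℂ G) (h0 : G 0 ≠ 0)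
    {C K : ℝ} (hgrowth : ∀ w, ‖G w‖ ≤ C * Real.exp (K * √‖w‖)) :
    ∃ A B : ℝ, ∀ R : ℝ, 0 < R → ∀ s : Finset ι, (∀ i ∈ s, ‖ζ i‖ ≤ R) →
      (s.card : ℝ) ≤ A + B * √R := by
  have hG0 : 0 < ‖G 0‖ := norm_pos_iff.2 h0
  have hC : 0 < C := by
    have := hgrowth 0
    simp at this
    linarith
  have hl : 0 < Real.log 2 := Real.log_pos (by norm_num)
  refine ⟨(Real.log C - Real.log ‖G 0‖) / Real.log 2, K * √3 / Real.log 2, fun R hR s hs => ?_⟩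
  obtain ⟨g, hg⟩ := hG.exists_isCofactor hd h0 s
  -- Jensen's argument in its crudest form: `c = 2` and `w = 0` give `|G 0| * 2 ^ card ≤ C exp(K
  -- √(3R))`, and logarithms yield the constants.
  have h := hg.norm_mul_pow_le hgrowth hR (c := 2) (by norm_num)
    (fun i hi => ⟨hG.apply_ne_zero h0 i, hs i hi⟩) (w := 0) (by simp; positivity)
  rw [hg.apply_zero, norm_mul, norm_pow, Complex.norm_real, Real.norm_of_nonneg (by norm_num)] at h
  have h1 := Real.log_le_log (by positivity) h
  rw [Real.log_mul hG0.ne' (by positivity), Real.log_pow, Real.log_mul hC.ne' (by positivity),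
    Real.log_exp] at h1
  rw [← mul_div_right_comm, ← add_div, le_div_iff₀ hl, mul_assoc, ← Real.sqrt_mul (by norm_num)]
  norm_num [-Nat.ofNat_nonneg, -Real.sqrt_mul] at h1
  linarith

/-- Split into dyadic shells `2^n ≤ |ζ|/δ < 2^(n+1)`. Such a shell has `O(2^(n/2))` members, each
contributing `O(2^(-n))`, so a geometric series of ratio `√2 / 2` dominates. -/
theorem summable_norm_inv_of_card_le {δ A B : ℝ} (hδ : 0 < δ) (hζ : ∀ i, δ ≤ ‖ζ i‖)
    (hcard : ∀ R : ℝ, 0 < R → ∀ s : Finset ι, (∀ i ∈ s, ‖ζ i‖ ≤ R) →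
      (s.card : ℝ) ≤ A + B * √R) :
    Summable fun i => ‖(ζ i)⁻¹‖ := by
  classical
  have hex : ∀ i, ∃ n : ℕ, (2 : ℝ) ^ n ≤ ‖ζ i‖ / δ ∧ ‖ζ i‖ / δ < 2 ^ (n + 1) := fun i =>
    exists_nat_pow_near ((one_le_div hδ).2 (hζ i)) (by norm_num)
  choose j hj1 hj2 using hex
  let b : ℕ → ℝ := fun n => (A + B * √(δ * 2 ^ (n + 1))) * (δ⁻¹ * (1 / 2) ^ n)
  have hbs : Summable b := by
    have h1 : Summable fun n : ℕ => (A * δ⁻¹) * (1 / 2 : ℝ) ^ n :=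
      (summable_geometric_of_lt_one (by norm_num) (by norm_num)).mul_left _
    have h2 : Summable fun n : ℕ => (B * √(δ * 2) * δ⁻¹) * (√2 / 2 : ℝ) ^ n := by
      refine (summable_geometric_of_lt_one (by positivity) ?_).mul_left _
      rw [div_lt_one (by norm_num), Real.sqrt_lt' (by norm_num)]
      norm_num
    refine (h1.add h2).congr fun n => ?_
    have : √(δ * 2 ^ (n + 1)) = √(δ * 2) * √2 ^ n := by
      have hp : √((2 : ℝ) ^ n) = √2 ^ n := by
        rw [Real.sqrt_eq_iff_mul_self_eq (by positivity) (by positivity), ← mul_pow,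
          Real.mul_self_sqrt (by norm_num)]
      rw [pow_succ', ← mul_assoc, Real.sqrt_mul (by positivity), hp]
    simp only [b, this]
    rw [div_pow, div_pow]
    ring
  have hfib : ∀ (s : Finset ι) (n : ℕ),
      ((s.filter fun i => j i = n).card : ℝ) ≤ A + B * √(δ * 2 ^ (n + 1)) := fun s n => by
    refine hcard _ (by positivity) _ fun i hi => ?_
    have := hj2 i
    rw [(Finset.mem_filter.1 hi).2, div_lt_iff₀ hδ] at this
    linarith
  -- No sign is known for `A` and `B`; the count for the empty set shows that the bound is
  -- nonnegative.
  have hb0 : ∀ n, 0 ≤ b n := fun n =>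
    mul_nonneg ((Nat.cast_nonneg _).trans (hfib ∅ n)) (by positivity)
  refine summable_of_sum_le (c := ∑' n, b n) (fun i => norm_nonneg _) fun s => ?_
  calc ∑ i ∈ s, ‖(ζ i)⁻¹‖ ≤ ∑ i ∈ s, δ⁻¹ * (1 / 2) ^ j i := by
        refine Finset.sum_le_sum fun i _ => ?_
        have hi : 0 < ‖ζ i‖ := hδ.trans_le (hζ i)
        have := hj1 i
        rw [le_div_iff₀ hδ] at this
        rw [norm_inv, one_div, inv_pow, ← mul_inv]
        refine inv_anti₀ (by positivity) (by linarith)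
    _ = ∑ n ∈ s.image j, ∑ i ∈ s with j i = n, δ⁻¹ * (1 / 2) ^ j i :=
        (Finset.sum_fiberwise_of_maps_to (fun i hi => Finset.mem_image_of_mem j hi) _).symm
    _ ≤ ∑ n ∈ s.image j, b n := by
        refine Finset.sum_le_sum fun n _ => ?_
        rw [Finset.sum_congr rfl (g := fun _ => δ⁻¹ * (1 / 2) ^ n)
          (fun i hi => by rw [(Finset.mem_filter.1 hi).2]), Finset.sum_const, nsmul_eq_mul]
        exact mul_le_mul_of_nonneg_right (hfib s n) (by positivity)
    _ ≤ ∑' n, b n := hbs.sum_le_tsum _ fun n _ => hb0 n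

theorem ListsZeros.summable_norm_inv (hG : ListsZeros G ζ) (hd : Differentiable ℂ G) (h0 : G 0 ≠ 0)
    {C K : ℝ} (hgrowth : ∀ w, ‖G w‖ ≤ C * Real.exp (K * √‖w‖)) :
    Summable fun i => ‖(ζ i)⁻¹‖ := by
  obtain ⟨A, B, hAB⟩ := hG.exists_card_le hd h0 hgrowth
  -- By continuity `G` has no zero in a disc of some radius `δ` about 0.
  obtain ⟨δ, hδ, hball⟩ := Metric.eventually_nhds_iff.1 (hd.continuous.continuousAt.eventually_ne h0)
  refine summable_norm_inv_of_card_le hδ (fun i => ?_) hAB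
  by_contra! hlt
  have h1 : analyticOrderAt G (ζ i) = 0 :=
    analyticOrderAt_eq_zero.2 (Or.inr (hball (by simpa using hlt)))
  rw [← hG, Set.encard_eq_zero] at h1
  exact (Set.ext_iff.1 h1 i).1 rfl

theorem ListsZeros.finite_setOf_norm_le (hG : ListsZeros G ζ) (hd : Differentiable ℂ G)
    (h0 : G 0 ≠ 0) {C K : ℝ} (hgrowth : ∀ w, ‖G w‖ ≤ C * Real.exp (K * √‖w‖))
    (R : ℝ) : {i | ‖ζ i‖ ≤ R}.Finite := by
  have h := (hG.summable_norm_inv hd h0 hgrowth).tendsto_cofinite_zero.eventually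
    (gt_mem_nhds (show (0 : ℝ) < (|R| + 1)⁻¹ by positivity))
  refine (Filter.eventually_cofinite.1 h).subset fun i hi => ?_
  simp only [Set.mem_ofPred_eq, not_lt, norm_inv] at hi ⊢
  have := norm_pos_iff.2 (hG.apply_ne_zero h0 i)
  gcongr
  linarith [le_abs_self R]

end Cofactor

/-! ### Cofactors become constant -/

/-- A function without zeros on a disc has a holomorphic logarithm there. -/
theorem exists_holomorphic_log_ball {g : ℂ → ℂ} {R : ℝ} (hd : Differentiable ℂ g)
    (hg : ∀ w ∈ Metric.ball (0 : ℂ) R, g w ≠ 0) :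
    ∃ h : ℂ → ℂ, h 0 = 0 ∧ DifferentiableOn ℂ h (Metric.ball 0 R) ∧
      ∀ w ∈ Metric.ball (0 : ℂ) R, g w = g 0 * Complex.exp (h w) := by
  have hq : DifferentiableOn ℂ (fun w => deriv g w / g w) (Metric.ball 0 R) :=
    (hd.deriv.differentiableOn).div hd.differentiableOn hg
  obtain ⟨h, h0, hh⟩ := hq.isExactOn_ball.with_val_at 0 0
  refine ⟨h, h0, fun w hw => (hh w hw).differentiableAt.differentiableWithinAt, fun w hw => ?_⟩
  -- `h` is a primitive of `g'/g`, so `g * exp(-h)` has derivative zero.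
  have hF : ∀ x ∈ Metric.ball (0 : ℂ) R, HasDerivAt (fun w => g w * Complex.exp (-h w)) 0 x := by
    intro x hx
    refine ((hd x).hasDerivAt.mul (hh x hx).neg.cexp).congr_deriv ?_
    field_simp [hg x hx]
    ring
  have hR : 0 < R := dist_nonneg.trans_lt (Metric.mem_ball.1 hw)
  have hc := Metric.isOpen_ball.is_const_of_deriv_eq_zero
    (convex_ball (0 : ℂ) R).isPreconnected
    (fun x hx => (hF x hx).differentiableAt.differentiableWithinAt)
    (fun x hx => (hF x hx).deriv) hw (Metric.mem_ball_self hR)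
  simp only [h0, neg_zero, Complex.exp_zero, mul_one] at hc
  rw [← hc, mul_assoc, ← Complex.exp_add, neg_add_cancel, Complex.exp_zero, mul_one]

/-- A bounded function without zeros on a large disc is nearly constant on the unit disc. -/
theorem norm_sub_apply_zero_le {g : ℂ → ℂ} {R M : ℝ} (hd : Differentiable ℂ g)
    (hg : ∀ w ∈ Metric.ball (0 : ℂ) R, g w ≠ 0) (hR : 1 < R)
    (hM : ∀ w ∈ Metric.ball (0 : ℂ) R, ‖g w‖ ≤ M)
    (hsmall : 2 * (Real.log M - Real.log ‖g 0‖ + 1) / (R - 1) ≤ 1) {w : ℂ} (hw : ‖w‖ ≤ 1) :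
    ‖g w - g 0‖ ≤ 4 * ‖g 0‖ * ((Real.log M - Real.log ‖g 0‖ + 1) / (R - 1)) := by
  obtain ⟨h, h0, hhd, hh⟩ := exists_holomorphic_log_ball hd hg
  have hR0 : 0 < R := by linarith
  have hg0 : 0 < ‖g 0‖ := norm_pos_iff.2 (hg 0 (Metric.mem_ball_self hR0))
  have hM0 : ‖g 0‖ ≤ M := hM 0 (Metric.mem_ball_self hR0)
  -- The added 1 makes `L` strictly positive, as Borel–Carathéodory demands.
  set L := Real.log M - Real.log ‖g 0‖ + 1 with hL
  have hLpos : 0 < L := by linarith [Real.log_le_log hg0 hM0]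
  have hre : Set.MapsTo h (Metric.ball 0 R) {z | z.re ≤ L} := fun x hx => by
    have h1 := hM x hx
    rw [hh x hx, norm_mul, Complex.norm_exp] at h1
    have h2 := Real.log_le_log (by positivity) h1
    rw [Real.log_mul hg0.ne' (by positivity), Real.log_exp] at h2
    simp only [Set.mem_ofPred_eq]
    linarith
  have hwR : w ∈ Metric.ball (0 : ℂ) R := by simpa using hw.trans_lt hR
  have hbc := Complex.borelCaratheodory_zero hLpos hhd hre hR0 hwR h0
  have hle : ‖h w‖ ≤ 2 * L / (R - 1) := by
    refine hbc.trans ?_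
    have : 0 < R - 1 := by linarith
    have h3 : 2 * L * ‖w‖ ≤ 2 * L * 1 := by gcongr
    rw [mul_one] at h3
    gcongr
  -- `hsmall` puts `h w` in the unit disc, where `|e^h - 1| ≤ 2|h|`.
  have hexp := Complex.norm_exp_sub_one_le (hle.trans hsmall)
  rw [hh w hwR, ← mul_sub_one, norm_mul]
  calc ‖g 0‖ * ‖Complex.exp (h w) - 1‖ ≤ ‖g 0‖ * (2 * (2 * L / (R - 1))) := by gcongr; linarith
    _ = _ := by ring

/-- Cauchy's estimate on the unit circle for `g - g 0`, which has the same derivatives of positive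
order as `g`. -/
theorem norm_coeff_taylorAtZero_le {g : ℂ → ℂ} {ε : ℝ} (hd : Differentiable ℂ g)
    (hε : ∀ w, ‖w‖ ≤ 1 → ‖g w - g 0‖ ≤ ε) {n : ℕ} (hn : n ≠ 0) :
    ‖PowerSeries.coeff n (taylorAtZero g)‖ ≤ ε := by
  have h := Complex.norm_iteratedDeriv_le_of_forall_mem_sphere_norm_le (c := 0) (R := 1)
    (f := fun w => g w - g 0) n one_pos (by fun_prop : Differentiable ℂ _).diffContOnCl
    (fun z hz => hε z (by simpa using (mem_sphere_zero_iff_norm.1 hz).le))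
  have hpos : (0 : ℝ) < n.factorial := by positivity
  have h2 : iteratedDeriv n (fun w => g w - g 0) 0 = iteratedDeriv n g 0 := by
    obtain ⟨m, rfl⟩ := Nat.exists_eq_succ_of_ne_zero hn
    rw [iteratedDeriv_succ', iteratedDeriv_succ']
    congr 1
    ext w
    simp
  rw [h2, one_pow, div_one] at h
  rw [coeff_taylorAtZero, norm_div, Complex.norm_natCast, div_le_iff₀ hpos]
  linarith

section Cofactor

variable {ι : Type*} {G : ℂ → ℂ} {ζ : ι → ℂ}

/-- The cofactors belonging to larger and larger discs tend to a constant. -/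
theorem ListsZeros.exists_coeff_cofactor_le (hG : ListsZeros G ζ) (h0 : G 0 ≠ 0)
    {C K : ℝ} (hgrowth : ∀ w, ‖G w‖ ≤ C * Real.exp (K * √‖w‖)) :
    ∃ ε : ℝ → ℝ, Tendsto ε atTop (𝓝 0) ∧ ∀ᶠ R in atTop, ∀ (s : Finset ι) (g : ℂ → ℂ),
      (∀ i, i ∈ s → ‖ζ i‖ ≤ R) → (∀ i, ‖ζ i‖ < R → i ∈ s) → IsCofactor G ζ s g →
      ∀ n ≠ 0, ‖PowerSeries.coeff n (taylorAtZero g)‖ ≤ ε R := by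
  have hG0 : 0 < ‖G 0‖ := norm_pos_iff.2 h0
  have hC : 0 < C := by
    have := hgrowth 0
    simp at this
    linarith
  -- This is `log M - log |g 0| + 1` for `M = C exp(K √(2R))`, the bound on the cofactor from `c =
  -- 1`. It is `O(√R)`, hence `o(R)`.
  let L : ℝ → ℝ := fun R => Real.log C - Real.log ‖G 0‖ + 1 + K * √2 * √R
  have hlim : Tendsto (fun R => L R / (R - 1)) atTop (𝓝 0) := by
    have h1 : Tendsto (fun R : ℝ => R - 1) atTop atTop := tendsto_atTop_add_const_right _ _ tendsto_id
    have h2 : Tendsto (fun R : ℝ => √R / (R - 1)) atTop (𝓝 0) := by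
      have h3 : Tendsto (fun R : ℝ => (√R - (√R)⁻¹)⁻¹) atTop (𝓝 0) := by
        refine Tendsto.inv_tendsto_atTop ?_
        exact Real.tendsto_sqrt_atTop.atTop_add
          ((tendsto_inv_atTop_zero.comp Real.tendsto_sqrt_atTop).neg)
      refine h3.congr' ?_
      filter_upwards [eventually_gt_atTop 1] with R hR
      have : √R * √R = R := Real.mul_self_sqrt (by linarith)
      have hs : √R ≠ 0 := (Real.sqrt_pos.2 (by linarith)).ne'
      have h4 : √R - (√R)⁻¹ = (R - 1) / √R := by
        field_simp
        nlinarith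
      rw [h4, inv_div]
    have h5 := (h1.inv_tendsto_atTop.const_mul (Real.log C - Real.log ‖G 0‖ + 1)).add
      (h2.const_mul (K * √2))
    simp only [mul_zero, add_zero] at h5
    refine h5.congr fun R => ?_
    simp only [L, Pi.inv_apply]
    ring
  refine ⟨fun R => 4 * ‖G 0‖ * (L R / (R - 1)), by simpa using hlim.const_mul (4 * ‖G 0‖), ?_⟩
  filter_upwards [eventually_gt_atTop 1, hlim.eventually (gt_mem_nhds (show (0:ℝ) < 1 / 2 by norm_num))]
    with R hR hsmall s g hs1 hs2 hg n hn
  have hlog : Real.log (C * Real.exp (K * √(2 * R))) - Real.log ‖g 0‖ + 1 = L R := by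
    rw [Real.log_mul hC.ne' (by positivity), Real.log_exp, hg.apply_zero,
      Real.sqrt_mul (by norm_num)]
    simp only [L]
    ring
  refine norm_coeff_taylorAtZero_le hg.differentiable (fun w hw => ?_) hn
  have hb := norm_sub_apply_zero_le (M := C * Real.exp (K * √(2 * R))) hg.differentiable
    (fun x hx hx0 => ?_) hR (fun x hx => ?_) ?_ hw
  · rw [hlog, hg.apply_zero] at hb
    rwa [hg.apply_zero]
  · have h1 : analyticOrderAt g x ≠ 0 :=
      analyticOrderAt_ne_zero.2 ⟨hg.differentiable.analyticAt x, hx0⟩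
    rw [← hg.encard_eq, Set.encard_ne_zero] at h1
    obtain ⟨i, hi, rfl⟩ := h1
    exact hi (hs2 i (by simpa using hx))
  · have := hg.norm_mul_pow_le hgrowth (R := R) (c := 1) (by linarith) (by norm_num)
      (fun i hi => ⟨hG.apply_ne_zero h0 i, hs1 i hi⟩) (w := x)
      (by have := mem_ball_zero_iff.1 hx; linarith)
    norm_num at this ⊢
    exact this
  · rw [hlog, mul_div_assoc]
    linarith

/-! ### Power sums and the logarithmic derivative -/

theorem summable_norm_pow {x : ι → ℂ} (hx : Summable fun i => ‖x i‖) {n : ℕ} (hn : n ≠ 0) :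
    Summable fun i => ‖x i ^ n‖ := by
  have hev := hx.tendsto_cofinite_zero.eventually (ge_mem_nhds zero_lt_one)
  refine Summable.of_norm_bounded_eventually hx ?_
  filter_upwards [hev] with i hi
  rw [norm_norm, norm_pow]
  exact pow_le_of_le_one (norm_nonneg _) hi hn

/-- The generating series `∑_{n ≥ 1} (∑_{i ∈ s} x_i ^ n) X ^ n` of the power sums. -/
noncomputable def powerSumSeries (x : ι → ℂ) (s : Finset ι) : PowerSeries ℂ :=
  ∑ i ∈ s, PowerSeries.mk fun n => if n = 0 then 0 else x i ^ n

theorem X_mul_derivative_prod [DecidableEq ι] (x : ι → ℂ) (s : Finset ι) :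
    PowerSeries.X * PowerSeries.derivative ℂ
        (∏ i ∈ s, (1 - PowerSeries.C (x i) * PowerSeries.X)) =
      -powerSumSeries x s * ∏ i ∈ s, (1 - PowerSeries.C (x i) * PowerSeries.X) := by
  induction s using Finset.induction_on with
  | empty => simp [powerSumSeries]
  | insert j s hj ih =>
    -- The geometric series `∑_{n ≥ 1} (x j)^n X^n`, with its denominator cleared.
    have h1 : (PowerSeries.mk fun n => if n = 0 then 0 else x j ^ n) *
        (1 - PowerSeries.C (x j) * PowerSeries.X) = PowerSeries.C (x j) * PowerSeries.X := by
      ext n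
      rw [mul_sub, mul_one, mul_left_comm, map_sub, PowerSeries.coeff_C_mul,
        PowerSeries.coeff_C_mul]
      rcases n with _ | _ | n
      · simp
      · simp [PowerSeries.coeff_succ_mul_X]
      · simp [PowerSeries.coeff_succ_mul_X, PowerSeries.coeff_X, pow_succ']
    rw [powerSumSeries, Finset.sum_insert hj, Finset.prod_insert hj, ← powerSumSeries,
      Derivation.leibniz]
    simp only [smul_eq_mul, map_sub, Derivation.leibniz, PowerSeries.derivative_C,
      PowerSeries.derivative_X, Derivation.map_one_eq_zero]
    linear_combination (1 - PowerSeries.C (x j) * PowerSeries.X) * ih +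
      (∏ i ∈ s, (1 - PowerSeries.C (x i) * PowerSeries.X)) * h1

theorem taylorAtZero_one_sub (x : ℂ) :
    taylorAtZero (fun w => 1 - x * w) = 1 - PowerSeries.C x * PowerSeries.X := by
  have h : IsEntireCoeff fun n => if n = 0 then 1 else if n = 1 then -x else 0 := fun R _ =>
    summable_of_ne_finset_zero (s := {0, 1}) fun n hn => by
      simp only [Finset.mem_insert, Finset.mem_singleton, not_or] at hn
      simp [hn.1, hn.2]
  have hp : (fun w => 1 - x * w) = powSum fun n => if n = 0 then 1 else if n = 1 then -x else 0 := by
    ext w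
    rw [powSum, tsum_eq_sum (s := {0, 1}) fun n hn => by
      simp only [Finset.mem_insert, Finset.mem_singleton, not_or] at hn
      simp [hn.1, hn.2]]
    simp
    ring
  rw [hp, h.taylorAtZero_powSum]
  ext n
  rcases n with _ | _ | n <;> simp [PowerSeries.coeff_one]

theorem taylorAtZero_prod [DecidableEq ι] (x : ι → ℂ) (s : Finset ι) :
    taylorAtZero (fun w => ∏ i ∈ s, (1 - x i * w)) =
      ∏ i ∈ s, (1 - PowerSeries.C (x i) * PowerSeries.X) := by
  induction s using Finset.induction_on with
  | empty => simpa using taylorAtZero_one_sub 0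
  | insert j s hj ih =>
    simp only [Finset.prod_insert hj]
    rw [taylorAtZero_mul (by fun_prop) (by fun_prop), ih, taylorAtZero_one_sub]

theorem IsCofactor.taylorAtZero_eq {s : Finset ι} {g : ℂ → ℂ}
    (hg : IsCofactor G ζ s g) : taylorAtZero G =
      (∏ i ∈ s, (1 - PowerSeries.C (ζ i)⁻¹ * PowerSeries.X)) * taylorAtZero g := by
  classical
  rw [← taylorAtZero_prod, ← taylorAtZero_mul (by fun_prop) hg.differentiable]
  exact congrArg _ (funext hg.eq_prod_mul)

theorem constantCoeff_taylorAtZero (f : ℂ → ℂ) : PowerSeries.coeff 0 (taylorAtZero f) = f 0 := by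
  simp [coeff_taylorAtZero]

/-- An entire function of order `1/2` with finitely many zeros is a polynomial. -/
theorem ListsZeros.exists_coeff_eq_zero [Finite ι] (hG : ListsZeros G ζ) (hd : Differentiable ℂ G)
    (h0 : G 0 ≠ 0) {C K : ℝ} (hgrowth : ∀ w, ‖G w‖ ≤ C * Real.exp (K * √‖w‖)) :
    ∃ N, ∀ n > N, PowerSeries.coeff n (taylorAtZero G) = 0 := by
  classical
  cases nonempty_fintype ι
  obtain ⟨ε, hε, hev⟩ := hG.exists_coeff_cofactor_le h0 hgrowth
  obtain ⟨g, hg⟩ := hG.exists_isCofactor hd h0 Finset.univ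
  have hc : taylorAtZero g = PowerSeries.C (G 0) := by
    ext n
    rcases eq_or_ne n 0 with rfl | hn
    · rw [constantCoeff_taylorAtZero, hg.apply_zero]; simp
    · rw [PowerSeries.coeff_C, if_neg hn, ← norm_le_zero_iff]
      refine ge_of_tendsto hε ?_
      -- Once the disc contains all the zeros the cofactor no longer depends on `R`, so each of its
      -- nonconstant coefficients is bounded by a quantity tending to 0.
      obtain ⟨B, hB⟩ := (Set.finite_range fun i => ‖ζ i‖).bddAbove
      filter_upwards [hev, eventually_ge_atTop B] with R hR hRB
      exact hR _ g (fun i _ => (hB ⟨i, rfl⟩).trans hRB) (by simp) hg n hn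
  let p : Polynomial ℂ := (∏ i, (1 - Polynomial.C (ζ i)⁻¹ * Polynomial.X)) * Polynomial.C (G 0)
  refine ⟨p.natDegree, fun n hn => ?_⟩
  have hp : taylorAtZero G = (p : PowerSeries ℂ) := by
    rw [hg.taylorAtZero_eq, hc]
    simp only [p, ← Polynomial.coeToPowerSeries.ringHom_apply, map_mul, map_prod, map_sub, map_one]
    simp [Polynomial.coeToPowerSeries.ringHom_apply]
  rw [hp, Polynomial.coeff_coe, Polynomial.coeff_eq_zero_of_natDegree_lt hn]

open scoped PowerSeries.WithPiTopology in
/-- The logarithmic derivative of an entire function of order `1/2`, as an identity of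
formal power series. -/
theorem ListsZeros.X_mul_derivative (hG : ListsZeros G ζ) (hd : Differentiable ℂ G)
    (h0 : G 0 ≠ 0) {C K : ℝ} (hgrowth : ∀ w, ‖G w‖ ≤ C * Real.exp (K * √‖w‖)) :
    PowerSeries.X * PowerSeries.derivative ℂ (taylorAtZero G) =
      -(PowerSeries.mk fun n => if n = 0 then 0 else ∑' i, (ζ i)⁻¹ ^ n) * taylorAtZero G := by
  classical
  obtain ⟨ε, hε, hev⟩ := hG.exists_coeff_cofactor_le h0 hgrowth
  have hfin := fun R => hG.finite_setOf_norm_le hd h0 hgrowth R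
  have hsum := hG.summable_norm_inv hd h0 hgrowth
  let s : ℕ → Finset ι := fun N => (hfin N).toFinset
  choose g hg using fun N => hG.exists_isCofactor hd h0 (s N)
  -- The discs exhaust the index set, so the sums over `s N` converge to the unconditional sums.
  have hs : Tendsto s atTop atTop := by
    refine tendsto_atTop_finset_of_monotone (fun M N hMN i hi => ?_) fun i => ?_
    · simp only [s, Set.Finite.mem_toFinset, Set.mem_ofPred_eq] at hi ⊢
      exact hi.trans (by exact_mod_cast hMN)
    · obtain ⟨N, hN⟩ := exists_nat_ge ‖ζ i‖
      exact ⟨N, by simpa [s] using hN⟩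
  have hγ : ∀ n ≠ 0, Tendsto (fun N => PowerSeries.coeff n (taylorAtZero (g N))) atTop (𝓝 0) := by
    intro n hn
    refine squeeze_zero_norm' ?_ (hε.comp tendsto_natCast_atTop_atTop)
    filter_upwards [tendsto_natCast_atTop_atTop.eventually hev] with N hN
    exact hN (s N) (g N) (fun i hi => by simpa [s] using hi) (fun i hi => by simpa [s] using hi.le)
      (hg N) n hn
  have hgl : Tendsto (fun N => taylorAtZero (g N)) atTop (𝓝 (PowerSeries.C (G 0))) := by
    rw [PowerSeries.WithPiTopology.tendsto_iff_coeff_tendsto]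
    intro n
    rcases eq_or_ne n 0 with rfl | hn
    · simp [constantCoeff_taylorAtZero, (hg _).apply_zero]
    · simpa [PowerSeries.coeff_C, hn] using hγ n hn
  have hdl : Tendsto (fun N => PowerSeries.X * PowerSeries.derivative ℂ (taylorAtZero (g N)))
      atTop (𝓝 0) := by
    rw [PowerSeries.WithPiTopology.tendsto_iff_coeff_tendsto]
    intro n
    rcases n with _ | n
    · simp
    · simp only [PowerSeries.coeff_succ_X_mul, PowerSeries.coeff_derivative, map_zero]
      simpa using (hγ (n + 1) (by omega)).mul_const ((n : ℂ) + 1)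
  have hSl : Tendsto (fun N => powerSumSeries (fun i => (ζ i)⁻¹) (s N)) atTop
      (𝓝 (PowerSeries.mk fun n => if n = 0 then 0 else ∑' i, (ζ i)⁻¹ ^ n)) := by
    rw [PowerSeries.WithPiTopology.tendsto_iff_coeff_tendsto]
    intro n
    simp only [powerSumSeries, map_sum, PowerSeries.coeff_mk]
    split_ifs with hn
    · simp
    · have h := (summable_norm_pow hsum hn).of_norm.hasSum
      rw [HasSum, SummationFilter.unconditional_filter] at h
      exact h.comp hs
  -- The product rule, multiplied by the cofactor once more so that the finite product occurs only
  -- inside `G`. In the limit the cofactor is the constant `G 0`, which cancels.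
  have hid : ∀ N, PowerSeries.X * PowerSeries.derivative ℂ (taylorAtZero G) * taylorAtZero (g N) =
      -powerSumSeries (fun i => (ζ i)⁻¹) (s N) * taylorAtZero G * taylorAtZero (g N) +
        taylorAtZero G * (PowerSeries.X * PowerSeries.derivative ℂ (taylorAtZero (g N))) := by
    intro N
    have h1 := X_mul_derivative_prod (fun i => (ζ i)⁻¹) (s N)
    rw [(hg N).taylorAtZero_eq, Derivation.leibniz]
    simp only [smul_eq_mul]
    linear_combination (taylorAtZero (g N)) ^ 2 * h1
  have hl := hgl.const_mul (PowerSeries.X * PowerSeries.derivative ℂ (taylorAtZero G))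
  have hr := ((hSl.neg.mul_const (taylorAtZero G)).mul hgl).add (hdl.const_mul (taylorAtZero G))
  have := tendsto_nhds_unique hl (hr.congr fun N => (hid N).symm)
  rw [mul_zero, add_zero] at this
  exact mul_right_cancel₀ (by simpa using h0) this

end Cofactor

/-! ### The Riccati equation -/

section RiccatiAlgebra

/-- Here `h_i`, `g_i`, `s₁` stand for `θ^i H`, `θ^i G`, `θS`. The polynomial `Q = q - px + a²x²` is
the determinant of `(G, θG)` in terms of `(H, θH)`, and `-px + 2a²x²` is `θQ`. With `δ = z d/dz`,
acting as `ν + 2θ`, the identity `key` is the second order equation `Q δ²N - (δQ) δN = (…) N`. -/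
theorem riccati_algebra {R : Type*} [CommRing R]
    {a b c ν x H h₁ h₂ h₃ G g₁ g₂ S s₁ p q : R}
    (hp : p = 2 * a * (a * ν ^ 2 + c) + (a ^ 2 - b ^ 2))
    (hq : q = (a * ν ^ 2 + c) ^ 2 - ν ^ 2 * (a - b) ^ 2)
    (h2 : 4 * h₂ + 4 * ν * h₁ = -(x * H))
    (h3 : 4 * h₃ + 4 * ν * h₂ = -(x * H) - x * h₁)
    (hG : G = (a * ν ^ 2 + c - a * x) * H + (b - a) * (ν * H + 2 * h₁))
    (hg1 : g₁ = -(a * x * H) + (a * ν ^ 2 + c - a * x) * h₁ + (b - a) * (ν * h₁ + 2 * h₂))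
    (hg2 : g₂ = -(a * x * H) - 2 * a * x * h₁ + (a * ν ^ 2 + c - a * x) * h₂
      + (b - a) * (ν * h₂ + 2 * h₃))
    (hS1 : g₁ = -(S * G)) (hS2 : g₂ = (S ^ 2 - s₁) * G) :
    4 * (q - p * x + a ^ 2 * x ^ 2) * (S ^ 2 - s₁ - ν * S) * G
        + 4 * (-(p * x) + 2 * a ^ 2 * x ^ 2) * S * G =
      (2 * ν * (-(p * x) + 2 * a ^ 2 * x ^ 2) - x * (q - p * x + a ^ 2 * x ^ 2)
        - 2 * (a * ν ^ 2 + c - a * x) * (b + a) * x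
        + 4 * a * x * ((b - a) * ν ^ 2 - (b + a) * x)) * G := by
  have key : (q - p * x + a ^ 2 * x ^ 2) * (4 * g₂ + 4 * ν * g₁ + ν ^ 2 * G)
      - 2 * (-(p * x) + 2 * a ^ 2 * x ^ 2) * (ν * G + 2 * g₁) =
      ((ν ^ 2 - x) * (q - p * x + a ^ 2 * x ^ 2)
        - 2 * (a * ν ^ 2 + c - a * x) * (b + a) * x
        + 4 * a * x * ((b - a) * ν ^ 2 - (b + a) * x)) * G := by
    rw [hg2, hg1, hG, hp, hq]
    linear_combination
      (((a * ν ^ 2 + c) ^ 2 - ν ^ 2 * (a - b) ^ 2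
          - (2 * a * (a * ν ^ 2 + c) + (a ^ 2 - b ^ 2)) * x + a ^ 2 * x ^ 2)
          * (a * ν ^ 2 + c - a * x + (b - a) * ν)
        - 2 * (b - a) * (-((2 * a * (a * ν ^ 2 + c) + (a ^ 2 - b ^ 2)) * x)
          + 2 * a ^ 2 * x ^ 2)) * h2
      + 2 * (b - a) * ((a * ν ^ 2 + c) ^ 2 - ν ^ 2 * (a - b) ^ 2
          - (2 * a * (a * ν ^ 2 + c) + (a ^ 2 - b ^ 2)) * x + a ^ 2 * x ^ 2) * h3
  rw [hS1, hS2] at key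
  linear_combination key

end RiccatiAlgebra

section RiccatiSeries

open PowerSeries

/-- The Riccati equation for `S = -X G' / G`, where `G` is the even part of `z^(-ν) N_ν(z)`. -/
theorem riccati_series {a b c ν : ℂ} {H G S : PowerSeries ℂ} (hG0 : G ≠ 0)
    (hH : 4 * (X * derivative ℂ (X * derivative ℂ H)) + 4 * C ν * (X * derivative ℂ H) = -(X * H))
    (hG : G = (C a * C ν ^ 2 + C c - C a * X) * H
      + (C b - C a) * (C ν * H + 2 * (X * derivative ℂ H)))
    (hS : X * derivative ℂ G = -S * G) :
    4 * (C (coeffQ a b c ν) - C (coeffP a b c ν) * X + C a ^ 2 * X ^ 2)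
          * (S ^ 2 - X * derivative ℂ S - C ν * S)
        + 4 * (-(C (coeffP a b c ν) * X) + 2 * C a ^ 2 * X ^ 2) * S =
      2 * C ν * (-(C (coeffP a b c ν) * X) + 2 * C a ^ 2 * X ^ 2)
        - X * (C (coeffQ a b c ν) - C (coeffP a b c ν) * X + C a ^ 2 * X ^ 2)
        - 2 * (C a * C ν ^ 2 + C c - C a * X) * (C b + C a) * X
        + 4 * C a * X * ((C b - C a) * C ν ^ 2 - (C b + C a) * X) := by
  have hd2 : derivative ℂ (2 : PowerSeries ℂ) = 0 := by
    simpa using (derivative ℂ).map_natCast 2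
  have hd4 : derivative ℂ (4 : PowerSeries ℂ) = 0 := by
    simpa using (derivative ℂ).map_natCast 4
  set h₁ := X * derivative ℂ H with hh1
  set h₂ := X * derivative ℂ h₁ with hh2
  set h₃ := X * derivative ℂ h₂ with hh3
  -- The operator `θ` applied to Bessel's equation.
  have h3 : 4 * h₃ + 4 * C ν * h₂ = -(X * H) - X * h₁ := by
    have := congrArg (fun f => X * derivative ℂ f) hH
    simp only [map_add, map_neg, Derivation.leibniz, smul_eq_mul, derivative_C, derivative_X,
      hd4] at this
    linear_combination this - 4 * hh3 - 4 * C ν * hh2 + X * hh1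
  have hg1 : X * derivative ℂ G = -(C a * X * H) + (C a * C ν ^ 2 + C c - C a * X) * h₁
      + (C b - C a) * (C ν * h₁ + 2 * h₂) := by
    rw [hG]
    simp only [map_add, map_sub, Derivation.leibniz, Derivation.leibniz_pow, smul_eq_mul,
      derivative_C, derivative_X, hd2]
    simp only [smul_zero, mul_zero, add_zero, zero_sub, mul_one]
    linear_combination -(C a * C ν ^ 2 + C c - C a * X + (C b - C a) * C ν) * hh1
      - 2 * (C b - C a) * hh2
  have hg2 : X * derivative ℂ (X * derivative ℂ G) = -(C a * X * H) - 2 * C a * X * h₁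
      + (C a * C ν ^ 2 + C c - C a * X) * h₂ + (C b - C a) * (C ν * h₂ + 2 * h₃) := by
    rw [hg1]
    simp only [map_add, map_neg, map_sub, Derivation.leibniz, Derivation.leibniz_pow, smul_eq_mul,
      derivative_C, derivative_X, hd2]
    simp only [smul_zero, mul_zero, add_zero, zero_sub, mul_one]
    linear_combination C a * X * hh1 - (C a * C ν ^ 2 + C c - C a * X + (C b - C a) * C ν) * hh2
      - 2 * (C b - C a) * hh3
  have hS2 : X * derivative ℂ (X * derivative ℂ G) = (S ^ 2 - X * derivative ℂ S) * G := by
    rw [hS, Derivation.leibniz]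
    simp only [map_neg, smul_eq_mul]
    linear_combination -S * hS
  refine mul_right_cancel₀ hG0 ?_
  have hp : C (coeffP a b c ν) =
      2 * C a * (C a * C ν ^ 2 + C c) + (C a ^ 2 - C b ^ 2) := by
    have h2 : (C 2 : PowerSeries ℂ) = 2 := map_ofNat C 2
    simp [coeffP, h2]
  have hq : C (coeffQ a b c ν) =
      (C a * C ν ^ 2 + C c) ^ 2 - C ν ^ 2 * (C a - C b) ^ 2 := by
    simp [coeffQ]
  have := riccati_algebra hp hq hH h3 hG hg1 hg2 (by rw [hS]; ring) hS2
  linear_combination this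

theorem coeff_sq_eq_sum_Icc {S : PowerSeries ℂ} (h0 : coeff 0 S = 0) (n : ℕ) :
    coeff n (S ^ 2) = ∑ m ∈ Finset.Icc 1 (n - 1), coeff m S * coeff (n - m) S := by
  rw [sq, coeff_mul, Finset.Nat.sum_antidiagonal_eq_sum_range_succ_mk]
  refine (Finset.sum_subset (fun m hm => ?_) fun m hm hm' => ?_).symm
  · simp only [Finset.mem_Icc, Finset.mem_range] at hm ⊢
    omega
  · simp only [Finset.mem_Icc, Finset.mem_range, not_and, not_le] at hm hm'
    rcases Nat.eq_zero_or_pos m with rfl | hm1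
    · simp [h0]
    · have : n - m = 0 := by have := hm' hm1; omega
      simp [this, h0]

/-- Coefficients of `X`, `X²`, `X³`, and then of `X^(k+1)` with `k ≥ 3`, where the right side no
longer contributes. -/
theorem riccati_coeff {p q e : ℂ} {ν r₁ r₂ r₃ : ℂ} {S : PowerSeries ℂ} (h0 : coeff 0 S = 0)
    (h : 4 * (C q - C p * X + C e * X ^ 2) * (S ^ 2 - X * derivative ℂ S - C ν * S)
        + 4 * (-(C p * X) + 2 * C e * X ^ 2) * S = C r₁ * X + C r₂ * X ^ 2 + C r₃ * X ^ 3) :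
    -(4 * q * (1 + ν) * coeff 1 S) = r₁ ∧
    4 * q * (coeff 1 S ^ 2 - (2 + ν) * coeff 2 S) + 4 * p * (1 + ν) * coeff 1 S
      - 4 * p * coeff 1 S = r₂ ∧
    4 * q * (2 * coeff 1 S * coeff 2 S - (3 + ν) * coeff 3 S)
      - 4 * p * (coeff 1 S ^ 2 - (2 + ν) * coeff 2 S) - 4 * e * (1 + ν) * coeff 1 S
      - 4 * p * coeff 2 S + 8 * e * coeff 1 S = r₃ ∧
    ∀ k, 3 ≤ k → q * (coeff (k + 1) (S ^ 2) - (k + 1 + ν) * coeff (k + 1) S)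
      - p * (coeff k (S ^ 2) - (k + ν) * coeff k S)
      + e * (coeff (k - 1) (S ^ 2) - (k - 1 + ν) * coeff (k - 1) S)
      - p * coeff k S + 2 * e * coeff (k - 1) S = 0 := by
  have hQ : ∀ n, coeff n (S ^ 2 - X * derivative ℂ S - C ν * S) =
      coeff n (S ^ 2) - (n + ν) * coeff n S := fun n => by
    rw [map_sub, map_sub, coeff_C_mul]
    rcases n with _ | n
    · simp [h0]
    · rw [coeff_succ_X_mul, coeff_derivative]
      push_cast
      ring
  set Q := S ^ 2 - X * derivative ℂ S - C ν * S with hQdef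
  have h' : C (4 * q) * Q - C (4 * p) * (X * Q) + C (4 * e) * (X * (X * Q))
      - C (4 * p) * (X * S) + C (8 * e) * (X * (X * S)) =
      C r₁ * X + C r₂ * (X * X) + C r₃ * (X * (X * X)) := by
    have h8 : (C 8 : PowerSeries ℂ) = 8 := map_ofNat C 8
    have h4 : (C 4 : PowerSeries ℂ) = 4 := map_ofNat C 4
    rw [map_mul, map_mul, map_mul, map_mul, h8, h4]
    linear_combination h
  have hc : ∀ n, _ := fun n => congrArg (coeff n) h'
  have s1 : coeff 1 (S ^ 2) = 0 := by simp [coeff_sq_eq_sum_Icc h0]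
  have s0 : coeff 0 (S ^ 2) = 0 := by simp [coeff_sq_eq_sum_Icc h0]
  have s2 : coeff 2 (S ^ 2) = coeff 1 S ^ 2 := by
    rw [coeff_sq_eq_sum_Icc h0]
    simp [sq]
  have s3 : coeff 3 (S ^ 2) = 2 * coeff 1 S * coeff 2 S := by
    simp [coeff_sq_eq_sum_Icc h0, Finset.sum_Icc_succ_top]
    ring
  have c1 := hc 1
  have c2 := hc 2
  have c3 := hc 3
  simp only [map_add, map_sub, coeff_C_mul, coeff_succ_X_mul, coeff_zero_X_mul, hQ, s0, s1, s2, s3,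
    h0, coeff_X] at c1 c2 c3
  norm_num at c1 c2 c3
  refine ⟨by linear_combination c1, by linear_combination c2, by linear_combination c3,
    fun k hk => ?_⟩
  obtain ⟨n, rfl⟩ := Nat.exists_eq_add_of_le' hk
  have cn := hc (n + 4)
  simp only [map_add, map_sub, coeff_C_mul, coeff_succ_X_mul, hQ, coeff_X] at cn
  simp only [show n + 4 ≠ 1 by omega, show n + 3 ≠ 1 by omega, show n + 2 ≠ 1 by omega,
    if_false] at cn
  push_cast at cn
  simp only [show n + 3 + 1 = n + 4 from rfl,
    show n + 3 - 1 = n + 2 from rfl]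
  push_cast
  linear_combination cn / 4

end RiccatiSeries

/-! ### Growth from factorial decay -/

/-- Coefficient sequences of entire functions of order at most `1/2`. -/
def HasFactorialBound (u : ℕ → ℂ) : Prop :=
  ∃ C K : ℝ, 0 ≤ C ∧ 1 ≤ K ∧ ∀ n, ‖u n‖ ≤ C * (K ^ n / ((2 * n).factorial : ℝ))

theorem HasFactorialBound.add {u v : ℕ → ℂ} (hu : HasFactorialBound u) (hv : HasFactorialBound v) :
    HasFactorialBound fun n => u n + v n := by
  obtain ⟨C, K, hC, hK, h⟩ := hu
  obtain ⟨C', K', hC', hK', h'⟩ := hv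
  refine ⟨C + C', max K K', by positivity, hK.trans (le_max_left _ _), fun n => ?_⟩
  refine (norm_add_le _ _).trans ?_
  rw [add_mul]
  refine add_le_add ((h n).trans ?_) ((h' n).trans ?_)
  · gcongr
    exact le_max_left _ _
  · gcongr
    exact le_max_right _ _

theorem HasFactorialBound.const_mul {u : ℕ → ℂ} (hu : HasFactorialBound u) (x : ℂ) :
    HasFactorialBound fun n => x * u n := by
  obtain ⟨C, K, hC, hK, h⟩ := hu
  refine ⟨‖x‖ * C, K, by positivity, hK, fun n => ?_⟩
  rw [norm_mul, mul_assoc]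
  gcongr
  exact h n

theorem HasFactorialBound.linear_mul {u : ℕ → ℂ} (hu : HasFactorialBound u) (μ : ℂ) :
    HasFactorialBound fun n => (μ + 2 * n) * u n := by
  obtain ⟨C, K, hC, hK, h⟩ := hu
  refine ⟨(‖μ‖ + 2) * C, 2 * K, by positivity, by linarith, fun n => ?_⟩
  have h1 : (n : ℝ) ≤ 2 ^ n := by exact_mod_cast n.lt_two_pow_self.le
  have h2 : (1 : ℝ) ≤ 2 ^ n := one_le_pow₀ (by norm_num)
  have h3 : ‖μ + 2 * (n : ℂ)‖ ≤ (‖μ‖ + 2) * 2 ^ n := by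
    refine (norm_add_le _ _).trans ?_
    simp only [norm_mul, Complex.norm_ofNat, Complex.norm_natCast]
    nlinarith [norm_nonneg μ]
  rw [norm_mul, mul_pow]
  calc _ ≤ (‖μ‖ + 2) * 2 ^ n * (C * (K ^ n / ((2 * n).factorial : ℝ))) := by
        gcongr
        exact h n
    _ = _ := by ring

theorem HasFactorialBound.norm_mul_pow_le {u : ℕ → ℂ} {C K : ℝ}
    (hK : 1 ≤ K) (h : ∀ n, ‖u n‖ ≤ C * (K ^ n / ((2 * n).factorial : ℝ))) {r : ℝ} (hr : 0 ≤ r)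
    (n : ℕ) : ‖u n‖ * r ^ n ≤ C * (√(K * r) ^ (2 * n) / ((2 * n).factorial : ℝ)) := by
  rw [pow_mul, Real.sq_sqrt (by positivity), mul_pow]
  calc ‖u n‖ * r ^ n ≤ C * (K ^ n / ((2 * n).factorial : ℝ)) * r ^ n := by gcongr; exact h n
    _ = _ := by ring

theorem HasFactorialBound.isEntireCoeff {u : ℕ → ℂ} (hu : HasFactorialBound u) :
    IsEntireCoeff u := fun r hr => by
  obtain ⟨C, K, hC, hK, h⟩ := hu
  exact Summable.of_nonneg_of_le (fun n => by positivity)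
    (HasFactorialBound.norm_mul_pow_le hK h hr) ((Real.hasSum_cosh _).summable.mul_left C)

theorem HasFactorialBound.exists_growth {u : ℕ → ℂ} (hu : HasFactorialBound u) :
    ∃ C K : ℝ, ∀ w, ‖powSum u w‖ ≤ C * Real.exp (K * √‖w‖) := by
  have hE := hu.isEntireCoeff
  obtain ⟨C, K, hC, hK, h⟩ := hu
  refine ⟨C, √K, fun w => ?_⟩
  -- The majorant `∑ (K|w|)^n / (2n)!` is `cosh √(K|w|)`.
  have hs := (Real.hasSum_cosh √(K * ‖w‖)).mul_left C
  have h1 : ‖powSum u w‖ ≤ C * Real.cosh √(K * ‖w‖) := by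
    refine tsum_of_norm_bounded hs fun n => ?_
    rw [norm_mul, norm_pow]
    exact HasFactorialBound.norm_mul_pow_le hK h (norm_nonneg w) n
  refine h1.trans ?_
  rw [← Real.sqrt_mul (by linarith)]
  gcongr
  rw [Real.cosh_eq]
  have : Real.exp (-√(K * ‖w‖)) ≤ Real.exp √(K * ‖w‖) :=
    Real.exp_le_exp.2 (by linarith [Real.sqrt_nonneg (K * ‖w‖)])
  linarith

theorem powSum_add {u v : ℕ → ℂ} (hu : IsEntireCoeff u) (hv : IsEntireCoeff v) (w : ℂ) :
    powSum (fun n => u n + v n) w = powSum u w + powSum v w := by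
  rw [powSum, powSum, powSum, ← (hu.summable w).tsum_add (hv.summable w)]
  simp only [add_mul]

theorem powSum_const_mul (u : ℕ → ℂ) (x w : ℂ) :
    powSum (fun n => x * u n) w = x * powSum u w := by
  simp only [powSum, mul_assoc, tsum_mul_left]

/-! ### The Bessel coefficients -/

/-- The coefficients of `z ^ (-ν) * J_ν z` as a power series in `z ^ 2`. -/
noncomputable def besselCoeff (ν : ℂ) (n : ℕ) : ℂ :=
  2 ^ (-ν) * ((-1) ^ n / (4 ^ n * n.factorial * Complex.Gamma (ν + n + 1)))

/-- The coefficients of `z ^ (-ν) * N_ν z` as a power series in `z ^ 2`. -/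
noncomputable def besselNCoeff (a b c ν : ℂ) (n : ℕ) : ℂ :=
  a * ((ν - 1 + 2 * n) * ((ν + 2 * n) * besselCoeff ν n)) + b * ((ν + 2 * n) * besselCoeff ν n)
    + c * besselCoeff ν n

section Coefficients

variable {ν : ℂ}

theorem besselCoeff_ne_zero (hν : ∀ n : ℕ, ν ≠ -((n : ℂ) + 1)) (n : ℕ) : besselCoeff ν n ≠ 0 := by
  have h : Complex.Gamma (ν + n + 1) ≠ 0 := Complex.Gamma_ne_zero fun m hm => by
    refine hν (n + m) ?_
    push_cast
    linear_combination hm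
  have h2 : (2 : ℂ) ^ (-ν) ≠ 0 := by simp [Complex.cpow_eq_zero_iff]
  have h3 : (n.factorial : ℂ) ≠ 0 := by exact_mod_cast n.factorial_ne_zero
  exact mul_ne_zero h2 (div_ne_zero (by simp) (by simp [h3, h]))

theorem besselCoeff_succ (hν : ∀ n : ℕ, ν ≠ -((n : ℂ) + 1)) (n : ℕ) :
    4 * (n + 1) * (ν + n + 1) * besselCoeff ν (n + 1) = -besselCoeff ν n := by
  have h0 : ν + n + 1 ≠ 0 := fun h => hν n (by linear_combination h)
  have h : Complex.Gamma (ν + n + 1) ≠ 0 := Complex.Gamma_ne_zero fun m hm => by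
    refine hν (n + m) ?_
    push_cast
    linear_combination hm
  have h3 : (n.factorial : ℂ) ≠ 0 := by exact_mod_cast n.factorial_ne_zero
  have h4 : (n : ℂ) + 1 ≠ 0 := by exact_mod_cast n.succ_ne_zero
  have hG : Complex.Gamma (ν + (n + 1 : ℕ) + 1) = (ν + n + 1) * Complex.Gamma (ν + n + 1) := by
    rw [← Complex.Gamma_add_one _ h0]
    push_cast
    ring_nf
  unfold besselCoeff
  rw [hG, Nat.factorial_succ]
  push_cast
  field_simp
  ring

/-- The normalized quantity `β n` is nonincreasing from some `N` on, hence bounded by the sum of its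
first values. -/
theorem hasFactorialBound_besselCoeff (hν : ∀ n : ℕ, ν ≠ -((n : ℂ) + 1)) :
    HasFactorialBound (besselCoeff ν) := by
  let β : ℕ → ℝ := fun n => ‖besselCoeff ν n‖ * ((2 * n).factorial : ℝ) / 2 ^ n
  have hβ0 : ∀ n, 0 ≤ β n := fun n => by positivity
  obtain ⟨N, hN⟩ := exists_nat_ge (2 * ‖ν‖)
  have hstep : ∀ n, N ≤ n → β (n + 1) ≤ β n := fun n hn => by
    have h1 := congrArg norm (besselCoeff_succ hν n)
    -- From `|ν| ≤ n / 2`. Then `4(n+1)|ν+n+1| ≥ 2(n+1)²`, just enough against `(2n+2)(2n+1) / 2`.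
    have h2 : (n + 1 : ℝ) / 2 ≤ ‖ν + n + 1‖ := by
      have h3 : ‖((n + 1 : ℕ) : ℂ)‖ ≤ ‖ν + n + 1‖ + ‖ν‖ := by
        have := norm_sub_le (ν + n + 1) ν
        refine le_trans (le_of_eq ?_) this
        congr 1
        push_cast
        ring
      rw [Complex.norm_natCast] at h3
      have h4 : (N : ℝ) ≤ n := by exact_mod_cast hn
      push_cast at h3
      linarith
    have h5 : ‖(n : ℂ) + 1‖ = n + 1 := by
      rw [← Nat.cast_succ, Complex.norm_natCast]
      push_cast
      rfl
    rw [norm_neg, norm_mul, norm_mul, norm_mul, h5, Complex.norm_ofNat] at h1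
    have hf : ((2 * (n + 1)).factorial : ℝ) = (2 * n + 2) * (2 * n + 1) * (2 * n).factorial := by
      rw [show 2 * (n + 1) = 2 * n + 1 + 1 by ring, Nat.factorial_succ, Nat.factorial_succ]
      push_cast
      ring
    simp only [β]
    rw [hf, ← h1, pow_succ, div_le_div_iff₀ (by positivity) (by positivity)]
    have h6 : (2 * n + 2) * (2 * n + 1) ≤ 4 * (n + 1) * ‖ν + n + 1‖ * 2 := by
      nlinarith
    have h7 : 0 ≤ ‖besselCoeff ν (n + 1)‖ * ((2 * n).factorial : ℝ) * 2 ^ n := by positivity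
    nlinarith [mul_le_mul_of_nonneg_left h6 h7]
  have hbd : ∀ n, β n ≤ ∑ k ∈ Finset.range (N + 1), β k := fun n => by
    rcases le_total n N with hn | hn
    · exact Finset.single_le_sum (f := β) (fun k _ => hβ0 k) (Finset.mem_range.2 (by omega))
    · induction n, hn using Nat.le_induction with
      | base => exact Finset.single_le_sum (f := β) (fun k _ => hβ0 k) (Finset.mem_range.2 (by omega))
      | succ n hn ih => exact (hstep n hn).trans ih
  refine ⟨∑ k ∈ Finset.range (N + 1), β k, 2, Finset.sum_nonneg fun k _ => hβ0 k, by norm_num,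
    fun n => ?_⟩
  have h := hbd n
  have hf : (0 : ℝ) < (2 * n).factorial := by positivity
  simp only [β] at h ⊢
  rw [div_le_iff₀ (by positivity)] at h
  rw [← mul_div_assoc, le_div_iff₀ hf]
  exact h

theorem hasFactorialBound_besselNCoeff (a b c : ℂ) (hν : ∀ n : ℕ, ν ≠ -((n : ℂ) + 1)) :
    HasFactorialBound (besselNCoeff a b c ν) := by
  have h := hasFactorialBound_besselCoeff hν
  have h1 := h.linear_mul ν
  exact (((h1.linear_mul (ν - 1)).const_mul a).add (h1.const_mul b)).add (h.const_mul c)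

theorem besselJ_eq {z : ℂ} (hz : z ≠ 0) :
    besselJ ν z = z ^ ν * powSum (besselCoeff ν) (z ^ 2) := by
  have hz2 : z / 2 ≠ 0 := by simpa using hz
  -- Scaling by a positive real keeps the argument, so the principal branches match.
  have hlog : Complex.log (z / 2) = Complex.log z - Complex.log 2 := by
    have h := Complex.log_mul_ofReal (1 / 2) (by norm_num) z hz
    rw [Real.log_div one_ne_zero two_ne_zero, Real.log_one, zero_sub, Complex.ofReal_neg,
      Complex.ofReal_log (by norm_num)] at h
    push_cast at h
    rw [mul_one_div] at h
    rw [h]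
    ring
  have hp : (z / 2) ^ ν = z ^ ν * 2 ^ (-ν) := by
    rw [Complex.cpow_def_of_ne_zero hz2, Complex.cpow_def_of_ne_zero hz,
      Complex.cpow_def_of_ne_zero two_ne_zero, ← Complex.exp_add, hlog]
    ring_nf
  rw [besselJ, powSum, ← tsum_mul_left]
  refine tsum_congr fun n => ?_
  have hn : (z / 2) ^ (2 * (n : ℂ) + ν) = (z ^ 2) ^ n / 4 ^ n * (z ^ ν * 2 ^ (-ν)) := by
    rw [Complex.cpow_add _ _ hz2, hp, ← Nat.cast_ofNat (R := ℂ) (n := 2), ← Nat.cast_mul,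
      Complex.cpow_natCast, pow_mul, div_pow, div_pow]
    norm_num
  rw [hn, besselCoeff]
  ring

theorem besselN_eq (a b c : ℂ) (hν : ∀ n : ℕ, ν ≠ -((n : ℂ) + 1)) {z : ℂ}
    (hz : z ∈ Complex.slitPlane) :
    besselN a b c ν z = z ^ ν * powSum (besselNCoeff a b c ν) (z ^ 2) := by
  have hE := (hasFactorialBound_besselCoeff hν)
  have hE1 := hE.linear_mul ν
  have hE2 := hE1.linear_mul (ν - 1)
  have hnhds : ∀ x ∈ Complex.slitPlane, Complex.slitPlane ∈ 𝓝 x := fun x hx =>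
    Complex.isOpen_slitPlane.mem_nhds hx
  have hz0 := Complex.slitPlane_ne_zero hz
  have h1 : ∀ x ∈ Complex.slitPlane, deriv (besselJ ν) x =
      x ^ (ν - 1) * powSum (fun n => (ν + 2 * n) * besselCoeff ν n) (x ^ 2) := fun x hx => by
    refine (HasDerivAt.congr_of_eventuallyEq (hE.isEntireCoeff.hasDerivAt_cpow_mul ν hx) ?_).deriv
    filter_upwards [hnhds x hx] with y hy
    exact besselJ_eq (Complex.slitPlane_ne_zero hy)
  have h2 : iteratedDeriv 2 (besselJ ν) z = z ^ (ν - 1 - 1) *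
      powSum (fun n => (ν - 1 + 2 * n) * ((ν + 2 * n) * besselCoeff ν n)) (z ^ 2) := by
    rw [iteratedDeriv_succ, iteratedDeriv_one]
    refine (HasDerivAt.congr_of_eventuallyEq
      (hE1.isEntireCoeff.hasDerivAt_cpow_mul (ν - 1) hz) ?_).deriv
    filter_upwards [hnhds z hz] with y hy
    exact h1 y hy
  have e1 : z * z ^ (ν - 1) = z ^ ν := by
    rw [Complex.cpow_sub _ _ hz0, Complex.cpow_one]
    field_simp
  have e2 : z ^ 2 * z ^ (ν - 1 - 1) = z ^ ν := by
    rw [Complex.cpow_sub _ _ hz0, Complex.cpow_sub _ _ hz0, Complex.cpow_one]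
    field_simp
  have hs : powSum (besselNCoeff a b c ν) (z ^ 2) = _ :=
    powSum_add ((hE2.const_mul a).add (hE1.const_mul b)).isEntireCoeff
      (hE.const_mul c).isEntireCoeff (z ^ 2)
  rw [powSum_add (hE2.const_mul a).isEntireCoeff (hE1.const_mul b).isEntireCoeff,
    powSum_const_mul, powSum_const_mul, powSum_const_mul] at hs
  rw [besselN, h2, h1 z hz, besselJ_eq hz0, hs, mul_add, mul_add, ← e1]
  nth_rw 4 [e1]
  rw [show z * z ^ (ν - 1) * (a * powSum
    (fun n => (ν - 1 + 2 * n) * ((ν + 2 * n) * besselCoeff ν n)) (z ^ 2)) =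
    z ^ 2 * z ^ (ν - 1 - 1) * (a * powSum
    (fun n => (ν - 1 + 2 * n) * ((ν + 2 * n) * besselCoeff ν n)) (z ^ 2)) by rw [e1, e2]]
  rw [← e1]
  ring

theorem besselNCoeff_zero_ne_zero {a b c : ℂ} (hν : ∀ n : ℕ, ν ≠ -((n : ℂ) + 1))
    (h0 : a * ν ^ 2 + c + (b - a) * ν ≠ 0) : besselNCoeff a b c ν 0 ≠ 0 := by
  have : besselNCoeff a b c ν 0 = (a * ν ^ 2 + c + (b - a) * ν) * besselCoeff ν 0 := by
    rw [besselNCoeff]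
    push_cast
    ring
  rw [this]
  exact mul_ne_zero h0 (besselCoeff_ne_zero hν 0)

/-- The `n`th coefficient is a nonvanishing Bessel coefficient times a polynomial of degree at most
2 in `n`. If that vanished for all large `n`, then `a = b = c = 0`, against `h0`; the second
difference is `8a`. -/
theorem exists_besselNCoeff_ne_zero {a b c : ℂ} (hν : ∀ n : ℕ, ν ≠ -((n : ℂ) + 1))
    (h0 : a * ν ^ 2 + c + (b - a) * ν ≠ 0) (N : ℕ) : ∃ n > N, besselNCoeff a b c ν n ≠ 0 := by
  by_contra! h
  have hP : ∀ n > N, a * ((ν - 1 + 2 * n) * (ν + 2 * n)) + b * (ν + 2 * n) + c = 0 := fun n hn => by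
    refine (mul_eq_zero.1 ?_).resolve_right (besselCoeff_ne_zero hν n)
    rw [← h n hn, besselNCoeff]
    ring
  have h1 := hP (N + 1) (by omega)
  have h2 := hP (N + 2) (by omega)
  have h3 := hP (N + 3) (by omega)
  push_cast at h1 h2 h3
  have ha : a = 0 := by linear_combination (h1 - 2 * h2 + h3) / 8
  subst ha
  have hb : b = 0 := by linear_combination (h2 - h1) / 2
  subst hb
  have hc : c = 0 := by linear_combination h1
  subst hc
  simp at h0

open PowerSeries in
theorem besselCoeff_series (hν : ∀ n : ℕ, ν ≠ -((n : ℂ) + 1)) :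
    4 * (X * derivative ℂ (X * derivative ℂ (mk (besselCoeff ν))))
      + 4 * C ν * (X * derivative ℂ (mk (besselCoeff ν))) = -(X * mk (besselCoeff ν)) := by
  have h4 : (4 : PowerSeries ℂ) = C 4 := (map_ofNat C 4).symm
  ext n
  rw [h4, ← map_mul]
  rcases n with _ | n
  · simp
  · simp only [map_add, map_neg, coeff_C_mul, coeff_succ_X_mul, coeff_derivative, coeff_mk]
    linear_combination besselCoeff_succ hν n

open PowerSeries in
-- Bessel's equation removes the second derivative: `z²J'' = -zJ' + (ν² - z²)J`.
theorem besselNCoeff_series (a b c : ℂ) (hν : ∀ n : ℕ, ν ≠ -((n : ℂ) + 1)) :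
    mk (besselNCoeff a b c ν) = (C a * C ν ^ 2 + C c - C a * X) * mk (besselCoeff ν)
      + (C b - C a) * (C ν * mk (besselCoeff ν) + 2 * (X * derivative ℂ (mk (besselCoeff ν)))) := by
  have h2 : (2 : PowerSeries ℂ) = C 2 := (map_ofNat C 2).symm
  have h : (C a * C ν ^ 2 + C c - C a * X) * mk (besselCoeff ν)
      + (C b - C a) * (C ν * mk (besselCoeff ν) + 2 * (X * derivative ℂ (mk (besselCoeff ν)))) =
      C (a * ν ^ 2 + c + (b - a) * ν) * mk (besselCoeff ν) - C a * (X * mk (besselCoeff ν))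
      + C (2 * (b - a)) * (X * derivative ℂ (mk (besselCoeff ν))) := by
    rw [h2]
    simp only [map_add, map_sub, map_mul, map_pow]
    ring
  obtain ⟨k, hk⟩ : ∃ k, k = a * ν ^ 2 + c + (b - a) * ν := ⟨_, rfl⟩
  rw [h, ← hk]
  ext n
  rcases n with _ | n
  · simp [besselNCoeff, hk]
    ring
  · simp only [map_add, map_sub, coeff_C_mul, coeff_succ_X_mul, coeff_derivative, coeff_mk,
      besselNCoeff]
    rw [hk]
    push_cast
    linear_combination a * besselCoeff_succ hν n

end Coefficients

/-! ### Zeros of `F(z) = G(z²)` in pairs -/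

section ZeroPairs

variable {F G : ℂ → ℂ}

theorem IsEntireQuotient.eq_of_eqOn {ν : ℂ} {f : ℂ → ℂ} (hF : IsEntireQuotient ν f F)
    (hG : Differentiable ℂ G)
    (h : ∀ z ∈ Complex.slitPlane, f z = z ^ ν * G (z ^ 2)) (z : ℂ) : F z = G (z ^ 2) := by
  have hG2 : Differentiable ℂ fun z => G (z ^ 2) := hG.comp (differentiable_id.pow 2)
  refine congrFun ((show AnalyticOnNhd ℂ F Set.univ from fun z _ =>
    hF.1.analyticAt z).eq_of_eventuallyEq (fun z _ => hG2.analyticAt z) (z₀ := 1) ?_) z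
  filter_upwards [Complex.isOpen_slitPlane.mem_nhds Complex.one_mem_slitPlane] with y hy
  rw [hF.2 y hy, h y hy, ← mul_assoc, ← Complex.cpow_add _ _ (Complex.slitPlane_ne_zero hy),
    neg_add_cancel, Complex.cpow_zero, one_mul]

theorem encard_add_encard_neg (t : ℕ → ℂ) {v : ℂ} (hv : v ≠ 0) :
    {k : ℕ | t k = v}.encard + {k : ℕ | -t k = v}.encard = {k | t k ^ 2 = v ^ 2}.encard := by
  rw [← Set.encard_union_eq]
  · congr 1
    ext k
    simp [sq_eq_sq_iff_eq_or_eq_neg, neg_eq_iff_eq_neg]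
  · rw [Set.disjoint_left]
    intro k hk hk'
    simp only [Set.mem_ofPred_eq] at hk hk'
    rw [hk, neg_eq_iff_add_eq_zero, ← two_mul] at hk'
    simp [hv] at hk'

/-- Away from 0 squaring is locally biholomorphic, so it preserves orders, and the two square roots
of `w` account for the two signs. At 0 neither function vanishes. -/
theorem isZeroPairSequence_iff (hG0 : G 0 ≠ 0) (hF : ∀ z, F z = G (z ^ 2))
    (t : ℕ → ℂ) :
    IsZeroPairSequence F t ↔ ListsZeros G fun k => t k ^ 2 := by
  have hF' : F = G ∘ fun z => z ^ 2 := funext hF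
  have hord : ∀ v : ℂ, v ≠ 0 → analyticOrderAt F v = analyticOrderAt G (v ^ 2) := fun v hv => by
    rw [hF']
    exact analyticOrderAt_comp_of_deriv_ne_zero (g := fun z : ℂ => z ^ 2) (by fun_prop)
      (by simpa using hv)
  have hG00 : analyticOrderAt G 0 = 0 := analyticOrderAt_eq_zero.2 (Or.inr hG0)
  have hF00 : analyticOrderAt F 0 = 0 := analyticOrderAt_eq_zero.2 (Or.inr (by simpa [hF] using hG0))
  constructor
  · intro h w
    obtain ⟨v, rfl⟩ := IsAlgClosed.exists_pow_nat_eq w two_pos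
    by_cases hv : v = 0
    · subst hv
      have h1 := h 0
      rw [hF00, add_eq_zero] at h1
      rw [zero_pow two_ne_zero, hG00, ← h1.1]
      congr 1
      ext k
      simp
    · rw [← hord v hv, ← h v, encard_add_encard_neg t hv]
  · intro h v
    by_cases hv : v = 0
    · subst hv
      have h1 := h 0
      rw [hG00, Set.encard_eq_zero, Set.eq_empty_iff_forall_notMem] at h1
      have h2 : ∀ k, t k ≠ 0 := fun k hk => h1 k (by simp [hk])
      simp [hF00, h2]
    · rw [hord v hv, ← h, encard_add_encard_neg t hv]

/-- The zeros of a non-zero entire function can be listed with multiplicity. -/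
theorem exists_listsZeros_sigma (hG : Differentiable ℂ G) (h0 : G 0 ≠ 0) :
    ListsZeros G fun i : (Σ w : {w // G w = 0}, Fin (analyticOrderNatAt G w)) => (i.1 : ℂ) := by
  have htop : ∀ w, analyticOrderAt G w ≠ ⊤ := fun w hw => by
    rw [AnalyticOnNhd.analyticOrderAt_eq_top_iff_eq_zero w fun z => hG.analyticAt z] at hw
    exact h0 (congrFun hw 0)
  intro w
  by_cases hw : G w = 0
  · have hset : {i : (Σ w : {w // G w = 0}, Fin (analyticOrderNatAt G w)) | (i.1 : ℂ) = w} =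
        Sigma.mk ⟨w, hw⟩ '' Set.univ := by
      ext ⟨⟨x, hx⟩, i⟩
      simp only [Set.mem_ofPred_eq, Set.image_univ, Set.mem_range]
      constructor
      · rintro rfl
        exact ⟨i, rfl⟩
      · rintro ⟨j, hj⟩
        exact (congrArg (fun i => (i.1 : ℂ)) hj).symm
    rw [hset, sigma_mk_injective.encard_image, Set.encard_univ, ENat.card_eq_coe_fintype_card,
      Fintype.card_fin]
    exact Nat.cast_analyticOrderNatAt (htop w)
  · rw [analyticOrderAt_eq_zero.2 (Or.inr hw), Set.encard_eq_zero, Set.eq_empty_iff_forall_notMem]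
    rintro ⟨⟨x, hx⟩, i⟩ rfl
    exact hw hx

/-- The zeros of `G` are infinite in number, since otherwise `G` would be a polynomial, and
countable, since each disc contains finitely many. Enumerate them and choose square roots. -/
theorem exists_isZeroPairSequence (hG0 : G 0 ≠ 0) (hG : Differentiable ℂ G)
    (hF : ∀ z, F z = G (z ^ 2)) {C K : ℝ} (hgrowth : ∀ w, ‖G w‖ ≤ C * Real.exp (K * √‖w‖))
    (hpoly : ∀ N, ∃ n > N, PowerSeries.coeff n (taylorAtZero G) ≠ 0) :
    ∃ t, IsZeroPairSequence F t := by
  have hζ := exists_listsZeros_sigma hG hG0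
  set ι := (Σ w : {w // G w = 0}, Fin (analyticOrderNatAt G w))
  set ζ : ι → ℂ := fun i => (i.1 : ℂ)
  have hinf : Infinite ι := by
    by_contra h
    rw [not_infinite_iff_finite] at h
    obtain ⟨N, hN⟩ := hζ.exists_coeff_eq_zero hG hG0 hgrowth
    obtain ⟨n, hn, hn'⟩ := hpoly N
    exact hn' (hN n hn)
  have hcount : Countable ι := by
    rw [← Set.countable_univ_iff]
    refine Set.Countable.mono (fun i _ => ?_) (Set.countable_iUnion fun N : ℕ =>
      (hζ.finite_setOf_norm_le hG hG0 hgrowth N).countable)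
    obtain ⟨N, hN⟩ := exists_nat_ge ‖ζ i‖
    exact Set.mem_iUnion.2 ⟨N, hN⟩
  obtain ⟨hden⟩ := nonempty_denumerable ι
  let e : ℕ ≃ ι := (Denumerable.eqv ι).symm
  choose t ht using fun k => IsAlgClosed.exists_pow_nat_eq (ζ (e k)) two_pos
  refine ⟨t, (isZeroPairSequence_iff hG0 hF t).2 fun w => ?_⟩
  rw [← hζ w, ← Set.encard_preimage_of_injective_subset_range e.injective
    (by simp [e.surjective.range_eq])]
  simp only [ht]
  rfl

end ZeroPairs

/-! ### The relations between the Rayleigh sums -/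

/-- The Rayleigh sums as coefficients of `-X G' / G`. -/
noncomputable def rayleighSeries (t : ℕ → ℂ) : PowerSeries ℂ :=
  PowerSeries.mk fun n => if n = 0 then 0 else ∑' i, (t i ^ 2)⁻¹ ^ n

theorem coeff_rayleighSeries (t : ℕ → ℂ) {n : ℕ} (hn : n ≠ 0) :
    PowerSeries.coeff n (rayleighSeries t) = rayleighSum t n := by
  simp [rayleighSeries, rayleighSum, hn, inv_pow]

theorem rayleighSum_relations {a b c ν : ℂ} (hν : ∀ n : ℕ, ν ≠ -((n : ℂ) + 1))
    (h0 : a * ν ^ 2 + c + (b - a) * ν ≠ 0) {t : ℕ → ℂ}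
    (hS : PowerSeries.X * PowerSeries.derivative ℂ (PowerSeries.mk (besselNCoeff a b c ν)) =
      -rayleighSeries t * PowerSeries.mk (besselNCoeff a b c ν)) {τ : ℕ → ℂ}
    (hτ : τ = rayleighSum t) {p q r : ℂ}
    (hp : p = coeffP a b c ν) (hq : q = coeffQ a b c ν) (hr : r = coeffR a b c ν) :
    4 * q * (1 + ν) * τ 1 = 2 * ν * p + q + 2 * r ∧
    4 * q * (ν + 2) * τ 2 =
      4 * q * τ 1 ^ 2 + 4 * ν * p * τ 1 - p - 4 * a ^ 2 * ν + 2 * a * (a + b) ∧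
    4 * q * (ν + 3) * τ 3 =
      4 * p * (ν + 1) * τ 2 - 4 * a ^ 2 * (ν - 1) * τ 1 + a ^ 2
        + 8 * q * τ 1 * τ 2 - 4 * p * τ 1 ^ 2 ∧
    ∀ k : ℕ, 3 ≤ k →
      q * (k + ν + 1) * τ (k + 1) =
        p * (k + ν - 1) * τ k - a ^ 2 * (k + ν - 3) * τ (k - 1)
          + q * ∑ m ∈ Finset.Icc 1 k, τ m * τ (k - m + 1)
          - p * ∑ m ∈ Finset.Icc 1 (k - 1), τ m * τ (k - m)
          + a ^ 2 * ∑ m ∈ Finset.Icc 1 (k - 2), τ m * τ (k - m - 1) := by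
  have hG0 : PowerSeries.mk (besselNCoeff a b c ν) ≠ 0 := fun h => by
    have := congrArg (PowerSeries.coeff 0) h
    rw [PowerSeries.coeff_mk, map_zero] at this
    exact besselNCoeff_zero_ne_zero hν h0 this
  have hS0 : PowerSeries.coeff 0 (rayleighSeries t) = 0 := by simp [rayleighSeries]
  have hτc : ∀ n, n ≠ 0 → PowerSeries.coeff n (rayleighSeries t) = τ n := fun n hn => by
    rw [coeff_rayleighSeries t hn, hτ]
  have hric := riccati_series hG0 (besselCoeff_series hν) (besselNCoeff_series a b c hν) hS
  rw [← hp, ← hq] at hric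
  -- `r₁`, `r₂`, `r₃` are the coefficients of the right side of the Riccati equation; `r₁` equals
  -- `-(2νp + q + 2r)`.
  obtain ⟨c1, c2, c3, ck⟩ := riccati_coeff (p := p) (q := q) (e := a ^ 2) (ν := ν)
    (r₁ := -2 * ν * p - q - 2 * (a * ν ^ 2 + c) * (b + a) + 4 * a * ((b - a) * ν ^ 2))
    (r₂ := 4 * ν * a ^ 2 + p - 2 * a * (b + a)) (r₃ := -a ^ 2) hS0 (by
      have h2 : (PowerSeries.C 2 : PowerSeries ℂ) = 2 := map_ofNat PowerSeries.C 2
      have h4 : (PowerSeries.C 4 : PowerSeries ℂ) = 4 := map_ofNat PowerSeries.C 4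
      simp only [map_add, map_sub, map_mul, map_pow, map_neg, h2, h4]
      linear_combination hric)
  rw [hτc 1 (by omega)] at c1 c2 c3
  rw [hτc 2 (by omega)] at c2 c3
  rw [hτc 3 (by omega)] at c3
  refine ⟨?_, by linear_combination -c2, by linear_combination -c3, fun k hk => ?_⟩
  · rw [hr, coeffR]
    linear_combination -c1
  · have h := ck k hk
    have hsq : ∀ n, PowerSeries.coeff n (rayleighSeries t ^ 2) =
        ∑ m ∈ Finset.Icc 1 (n - 1), τ m * τ (n - m) := fun n => by
      rw [coeff_sq_eq_sum_Icc hS0]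
      refine Finset.sum_congr rfl fun m hm => ?_
      rw [Finset.mem_Icc] at hm
      rw [hτc m (by omega), hτc (n - m) (by omega)]
    have e1 : ∑ m ∈ Finset.Icc 1 (k + 1 - 1), τ m * τ (k + 1 - m) =
        ∑ m ∈ Finset.Icc 1 k, τ m * τ (k - m + 1) := by
      refine Finset.sum_congr rfl fun m hm => ?_
      rw [Finset.mem_Icc] at hm
      rw [show k + 1 - m = k - m + 1 by omega]
    have e2 : ∑ m ∈ Finset.Icc 1 (k - 1 - 1), τ m * τ (k - 1 - m) =
        ∑ m ∈ Finset.Icc 1 (k - 2), τ m * τ (k - m - 1) := by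
      refine Finset.sum_congr rfl fun m hm => ?_
      rw [show k - 1 - m = k - m - 1 by omega]
    rw [hsq, hsq, hsq, e1, e2, hτc _ (by omega), hτc _ (by omega), hτc _ (by omega)] at h
    linear_combination -h

theorem besselN_zero_zero_one (ν z : ℂ) : besselN 0 0 1 ν z = besselJ ν z := by
  simp [besselN]

theorem rayleighSum_bessel {ν : ℂ} (hν : ∀ n : ℕ, ν ≠ -((n : ℂ) + 1)) {τ : ℕ → ℂ}
    (h2 : (ν + 2) * τ 2 = τ 1 ^ 2) (h3 : (ν + 3) * τ 3 = 2 * τ 1 * τ 2)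
    (hk : ∀ k : ℕ, 3 ≤ k →
      (k + ν + 1) * τ (k + 1) = ∑ m ∈ Finset.Icc 1 k, τ m * τ (k - m + 1)) (n : ℕ) (hn : 2 ≤ n) :
    τ n = (ν + n)⁻¹ * ∑ k ∈ Finset.Icc 1 (n - 1), τ k * τ (n - k) := by
  have hne : ν + n ≠ 0 := fun h => by
    refine hν (n - 1) ?_
    rw [Nat.cast_sub (by omega)]
    push_cast
    linear_combination h
  rw [eq_inv_mul_iff_mul_eq₀ hne]
  -- The uniform recurrence starts at `k = 3`, that is `n = 4`; the two smaller cases are the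
  -- special relations.
  rcases eq_or_ne n 2 with rfl | hn2
  · simp only [Nat.add_one_sub_one, Finset.Icc_self, Finset.sum_singleton]
    push_cast
    linear_combination h2
  rcases eq_or_ne n 3 with rfl | hn3
  · simp [Finset.sum_Icc_succ_top]
    linear_combination h3
  obtain ⟨k, rfl⟩ : ∃ k, n = k + 1 := ⟨n - 1, by omega⟩
  have h := hk k (by omega)
  have e1 : ∑ m ∈ Finset.Icc 1 (k + 1 - 1), τ m * τ (k + 1 - m) =
      ∑ m ∈ Finset.Icc 1 k, τ m * τ (k - m + 1) := by
    refine Finset.sum_congr rfl fun m hm => ?_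
    rw [Finset.mem_Icc] at hm
    rw [show k + 1 - m = k - m + 1 by omega]
  rw [e1, ← h]
  push_cast
  ring

theorem mainTheorem2 (a b c ν p q r : ℂ)
    (hν : ∀ n : ℕ, ν ≠ -((n : ℂ) + 1))
    (h0 : a * ν ^ 2 + c + (b - a) * ν ≠ 0)
    (hp : p = coeffP a b c ν) (hq : q = coeffQ a b c ν) (hr : r = coeffR a b c ν) :
    (∃ F : ℂ → ℂ, IsEntireQuotient ν (besselN a b c ν) F) ∧
    ∀ F : ℂ → ℂ, IsEntireQuotient ν (besselN a b c ν) F →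
      (∀ z : ℂ, F (-z) = F z) ∧
      (∃ t : ℕ → ℂ, IsZeroPairSequence F t) ∧
      ∀ (t : ℕ → ℂ) (τ : ℕ → ℂ), IsZeroPairSequence F t → τ = rayleighSum t →
        (∀ k : ℕ, t k ≠ 0) ∧
        (∀ n : ℕ, 1 ≤ n → Summable fun k : ℕ => ‖((t k ^ 2) ^ n)⁻¹‖) ∧
        (q ≠ 0 → τ 1 = (2 * ν * p + q + 2 * r) / (4 * q * (ν + 1))) ∧
        4 * q * (ν + 2) * τ 2 =
          4 * q * τ 1 ^ 2 + 4 * ν * p * τ 1 - p - 4 * a ^ 2 * ν + 2 * a * (a + b) ∧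
        4 * q * (ν + 3) * τ 3 =
          4 * p * (ν + 1) * τ 2 - 4 * a ^ 2 * (ν - 1) * τ 1 + a ^ 2
            + 8 * q * τ 1 * τ 2 - 4 * p * τ 1 ^ 2 ∧
        (∀ k : ℕ, 3 ≤ k →
          q * (k + ν + 1) * τ (k + 1) =
            p * (k + ν - 1) * τ k - a ^ 2 * (k + ν - 3) * τ (k - 1)
              + q * ∑ m ∈ Finset.Icc 1 k, τ m * τ (k - m + 1)
              - p * ∑ m ∈ Finset.Icc 1 (k - 1), τ m * τ (k - m)
              + a ^ 2 * ∑ m ∈ Finset.Icc 1 (k - 2), τ m * τ (k - m - 1)) ∧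
        (a = 0 → b = 0 → c = 1 →
          p = 0 ∧ q = 1 ∧ r = 0 ∧ (∀ z : ℂ, besselN a b c ν z = besselJ ν z) ∧
          τ 1 = 1 / (4 * (ν + 1)) ∧
          ∀ n : ℕ, 2 ≤ n →
            τ n = (ν + n)⁻¹ * ∑ k ∈ Finset.Icc 1 (n - 1), τ k * τ (n - k)) := by
  have hbound := hasFactorialBound_besselNCoeff a b c hν
  have hentire := hbound.isEntireCoeff
  have hG := hentire.differentiable
  obtain ⟨C, K, hgrowth⟩ := hbound.exists_growth
  have hG0 : powSum (besselNCoeff a b c ν) 0 ≠ 0 := by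
    rw [powSum_zero]
    exact besselNCoeff_zero_ne_zero hν h0
  have hN : ∀ z ∈ Complex.slitPlane, besselN a b c ν z = _ := fun z hz => besselN_eq a b c hν hz
  refine ⟨⟨fun z => powSum (besselNCoeff a b c ν) (z ^ 2), hG.comp (differentiable_id.pow 2),
    fun z hz => ?_⟩, fun F hF => ?_⟩
  · rw [hN z hz, ← mul_assoc, ← Complex.cpow_add _ _ (Complex.slitPlane_ne_zero hz),
      neg_add_cancel, Complex.cpow_zero, one_mul]
  have hFG := hF.eq_of_eqOn hG hN
  refine ⟨fun z => by rw [hFG, hFG, neg_sq], exists_isZeroPairSequence hG0 hG hFG hgrowth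
    fun N => ?_, fun t τ ht hτ => ?_⟩
  · simpa [hentire.taylorAtZero_powSum] using exists_besselNCoeff_ne_zero hν h0 N
  have hlist := (isZeroPairSequence_iff hG0 hFG t).1 ht
  have hsum := hlist.summable_norm_inv hG hG0 hgrowth
  have hS := hlist.X_mul_derivative hG hG0 hgrowth
  rw [hentire.taylorAtZero_powSum] at hS
  obtain ⟨c1, c2, c3, ck⟩ := rayleighSum_relations hν h0 hS hτ hp hq hr
  have hν1 : ν + 1 ≠ 0 := fun h => hν 0 (by push_cast; linear_combination h)
  have hτ1 : q ≠ 0 → τ 1 = (2 * ν * p + q + 2 * r) / (4 * q * (ν + 1)) := fun hq0 => by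
    rw [eq_div_iff (by simp [hq0, hν1])]
    linear_combination c1
  refine ⟨fun k hk => hlist.apply_ne_zero hG0 k (by simp [hk]), fun n hn => ?_, hτ1, c2, c3, ck,
    fun ha hb hc => ?_⟩
  · simpa only [inv_pow] using summable_norm_pow hsum (n := n) (by omega)
  · subst ha hb hc
    have hp0 : p = 0 := by rw [hp, coeffP]; ring
    have hq1 : q = 1 := by rw [hq, coeffQ]; ring
    have hr0 : r = 0 := by rw [hr, coeffR]; ring
    rw [hp0, hq1] at c2 c3 ck
    rw [hp0, hq1, hr0] at hτ1
    refine ⟨hp0, hq1, hr0, besselN_zero_zero_one ν, by simpa using hτ1 one_ne_zero, ?_⟩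
    refine rayleighSum_bessel hν (by linear_combination c2 / 4) (by linear_combination c3 / 4)
      fun k hk => ?_
    linear_combination ck k hk
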